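/- Let $(X,\mathfrak B,\mu)$ be a probability space and $r\colon X\to X$ a measurable, onto, finite-to-one map such that $\mu$ is strongly invariant: for every bounded measurable $f\colon X\to\mathbb C$ the function $x\mapsto \frac1{\#r^{-1}(x)}\sum_{r(y)=x}f(y)$ is $\mu$-measurable and $$\int_X f\,d\mu=\int_X\frac1{\#r^{-1}(x)}\sum_{r(y)=x}f(y)\,d\mu(x).$$ Assume that there are countably many measurable sets which separate any two distinct points of each fibre $r^{-1}(x)$ (as is the case when $X$ is a standard Borel space, or when the inverse branches of $r$ can be labelled measurably with measurable images). Then $\mu$ is $r$-invariant, so that $g\mapsto g\circ r$ is well defined on $L^\infty(X,\mu)$. Let $H$ be a complex Hilbert space, $S$ an isometry on $H$ and $\pi$ a normal (unital, $*$-preserving) representation of $L^\infty(X,\mu)$ on $H$ with $$S\pi(g)=\pi(g\circ r)S,\qquad g\in L^\infty(X,\mu),$$ and assume that $H$ is countably generated for $\pi$, i.e. $\pi(L^\infty(X,\mu))C$ spans a dense subspace of $H$ for some countable $C\subset H$ (for instance, $H$ separable). Let $(\hat H,\hat S,\hat\pi)$ be the covariant dilation of $(H,S,\pi)$: $\hat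 H$ is a Hilbert space containing $H$, $\hat S$ is a unitary on $\hat H$ with $\hat S|_H=S$, $\bigcup_{n\ge0}\hat S^{-n}H$ is dense in $\hat H$, and $\hat\pi$ is a representation of $L^\infty(X,\mu)$ on $\hat H$ with $\hat\pi(g)|_H=\pi(g)$ and $\hat S\hat\pi(g)=\hat\pi(g\circ r)\hat S$ for all $g$. Put $V_0=H$, $V_1=\hat S^{-1}H$ and $W_0=V_1\ominus V_0$. For a $\mu$-measurable $m\colon X\to\{0,1,\dots,\infty\}$ let $L^2(X,m,\mu)$ be the Hilbert space of square-integrable $f$ with $f(x)\in\mathbb C^{m(x)}$ for a.e. $x$, where $\mathbb C^\infty=\ell^2(\mathbb N)$. Such an $m$ is called a multiplicity function $m_K$ of $\hat\pi$ on a $\hat\pi$-invariant closed subspace $K$ if there is a unitary from $K$ onto $L^2(X,m,\mu)$ which carries $\hat\pi(g)|_K$ to multiplication by $g$ for every $g\in L^\infty(X,\mu)$. Then $V_0\subseteq V_1$, the spaces $V_1$ and $W_0$ are invariant under $\hat\pi$, multiplicity functions of $\hat\pi$ on $V_0$, $V_1$ and $W_0$ exist, and for any choice of them: (i) $m_{V_1}(x)=\sum_{r(y)=x}m_{V_0}(y)$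 for $\mu$-almost every $x\in X$; (ii) $m_{V_0}(x)+m_{W_0}(x)=\sum_{r(y)=x}m_{V_0}(y)$ for $\mu$-almost every $x\in X$. -/

import Mathlib

open MeasureTheory
open scoped ENNReal

noncomputable section

namespace MultiplicityDilation

section Dynamics

variable {X : Type*} [MeasurableSpace X]

/-- The averaging operator `f ↦ (x ↦ (#r⁻¹(x))⁻¹ ∑_{r(y)=x} f(y))`, for finite-to-one `r`. -/
def fibreAverage (r : X → X) (f : X → ℂ) (x : X) : ℂ :=
  ((r ⁻¹' {x}).ncard : ℂ)⁻¹ * ∑ᶠ y ∈ r ⁻¹' {x}, f y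

/-- `μ` is strongly invariant under `r`: for every bounded measurable `f`, the fibre average of `f`
is `μ`-measurable and has the same integral as `f`. -/
structure IsStronglyInvariant (r : X → X) (μ : Measure X) : Prop where
  aestronglyMeasurable : ∀ f : X → ℂ, Measurable f → (∃ C : ℝ, ∀ x, ‖f x‖ ≤ C) →
    AEStronglyMeasurable (fibreAverage r f) μ
  integral_eq : ∀ f : X → ℂ, Measurable f → (∃ C : ℝ, ∀ x, ‖f x‖ ≤ C) →
    ∫ x, f x ∂μ = ∫ x, fibreAverage r f x ∂μ

/-- Some countable family of measurable sets separates any two distinct points of each fibre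
of `r`. -/
def FibresCountablySeparated (r : X → X) : Prop :=
  ∃ B : ℕ → Set X, (∀ n, MeasurableSet (B n)) ∧
    ∀ y y' : X, r y = r y' → y ≠ y' → ∃ n, ¬ (y ∈ B n ↔ y' ∈ B n)

/-- The function `x ↦ ∑_{r(y)=x} m(y)`, for finite-to-one `r`. -/
def fibreSum (r : X → X) (m : X → ℕ∞) (x : X) : ℕ∞ :=
  ∑ᶠ y ∈ r ⁻¹' {x}, m y

/-- A strongly invariant measure is invariant, so that `g ↦ g ∘ r` is well defined on `L^∞`. -/
theorem IsStronglyInvariant.measurePreserving {r : X → X} {μ : Measure X} [IsFiniteMeasure μ]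
    (h : IsStronglyInvariant r μ) (hr : Measurable r) (hsurj : Function.Surjective r)
    (hfin : ∀ x, (r ⁻¹' {x}).Finite) : MeasurePreserving r μ μ := by
  refine ⟨hr, ?_⟩
  ext s hs
  rw [Measure.map_apply hr hs]
  have key : ∀ t : Set X, MeasurableSet t →
      ∫ x, t.indicator (fun _ => (1 : ℂ)) x ∂μ = ((μ.real t : ℝ) : ℂ) := by
    intro t ht
    rw [integral_indicator ht]
    simp
  have hm : Measurable ((r ⁻¹' s).indicator (fun _ => (1 : ℂ))) :=
    measurable_const.indicator (hr hs)
  have hb : ∃ C : ℝ, ∀ x, ‖(r ⁻¹' s).indicator (fun _ => (1 : ℂ)) x‖ ≤ C :=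
    ⟨1, fun x => (norm_indicator_le_norm_self _ x).trans (by simp)⟩
  have hav : fibreAverage r ((r ⁻¹' s).indicator (fun _ => (1 : ℂ))) =
      s.indicator (fun _ => (1 : ℂ)) := by
    funext x
    have hne : ((r ⁻¹' {x}).ncard : ℂ) ≠ 0 := by
      obtain ⟨y, hy⟩ := hsurj x
      exact_mod_cast (Set.ncard_pos (hfin x)).2 ⟨y, hy⟩ |>.ne'
    have hc : ∑ᶠ y ∈ r ⁻¹' {x}, (r ⁻¹' s).indicator (fun _ => (1 : ℂ)) y =
        ((r ⁻¹' {x}).ncard : ℂ) * s.indicator (fun _ => (1 : ℂ)) x := by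
      have : ∀ y ∈ r ⁻¹' {x}, (r ⁻¹' s).indicator (fun _ => (1 : ℂ)) y =
          s.indicator (fun _ => (1 : ℂ)) x := by
        intro y hy
        have hy' : r y = x := hy
        have hiff : y ∈ r ⁻¹' s ↔ x ∈ s := by rw [← hy']; rfl
        by_cases hx : x ∈ s <;> simp [Set.indicator, hiff, hx]
      rw [finsum_mem_congr rfl this, finsum_mem_eq_finite_toFinset_sum _ (hfin x),
        Finset.sum_const, nsmul_eq_mul, Set.ncard_eq_toFinset_card _ (hfin x)]
    rw [fibreAverage, hc, inv_mul_cancel_left₀ hne]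
  have h1 := h.integral_eq _ hm hb
  rw [hav, key _ (hr hs), key _ hs] at h1
  have h2 : μ.real (r ⁻¹' s) = μ.real s := by exact_mod_cast h1
  exact (measureReal_eq_measureReal_iff).1 h2

end Dynamics

section Representations

variable {X : Type*} [MeasurableSpace X]
variable {H : Type*} [NormedAddCommGroup H] [InnerProductSpace ℂ H] [CompleteSpace H]

/-- `π` is a (unital, `*`-preserving) representation of the algebra `L^∞(X, μ)` on `H`.
The product of `f` and `g` in `L^∞` is written `f • g`. -/
structure IsRepresentation {μ : Measure X} [IsFiniteMeasure μ]
    (π : Lp ℂ ∞ μ →ₗ[ℂ] (H →L[ℂ] H)) : Prop where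
  map_one : π (Lp.const ∞ μ (1 : ℂ)) = ContinuousLinearMap.id ℂ H
  map_mul : ∀ f g : Lp ℂ ∞ μ, π (f • g : Lp ℂ ∞ μ) = (π f).comp (π g)
  map_star : ∀ f : Lp ℂ ∞ μ, π (star f) = ContinuousLinearMap.adjoint (π f)

/-- `π` is normal: all its coefficient functionals are weak-`*` continuous on `L^∞ = (L¹)*`,
that is, given by integration against a function in `L¹(μ)`. -/
def IsNormalRep {μ : Measure X} (π : Lp ℂ ∞ μ →ₗ[ℂ] (H →L[ℂ] H)) : Prop :=
  ∀ ξ η : H, ∃ w : X → ℂ, Integrable w μ ∧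
    ∀ g : Lp ℂ ∞ μ, inner ℂ ξ (π g η) = ∫ x, g x * w x ∂μ

/-- `H` is countably generated as an `L^∞`-module: some countable set `C` of vectors has
`π(L^∞) C` total in `H`. This holds whenever `H` is separable. -/
def IsCountablyGenerated {μ : Measure X} (π : Lp ℂ ∞ μ →ₗ[ℂ] (H →L[ℂ] H)) : Prop :=
  ∃ C : Set H, C.Countable ∧
    (Submodule.span ℂ {v : H | ∃ g : Lp ℂ ∞ μ, ∃ k ∈ C, v = π g k}).topologicalClosure = ⊤

/-- The sequence space `ℓ²(ℕ)`. -/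
abbrev EllTwo : Type := lp (fun _ : ℕ => ℂ) 2

/-- `L²(X, m, μ)`: the square-integrable `f` with `f(x) ∈ ℂ^{m(x)}` for almost every `x`, where
`ℂ^n ⊆ ℓ²(ℕ)` is spanned by the first `n` coordinate vectors and `ℂ^∞ = ℓ²(ℕ)`. -/
def LTwoMult (μ : Measure X) (m : X → ℕ∞) : Submodule ℂ (Lp EllTwo 2 μ) where
  carrier := {f | ∀ᵐ x ∂μ, ∀ i : ℕ, m x ≤ (i : ℕ∞) → (f x) i = 0}
  zero_mem' := by
    filter_upwards [Lp.coeFn_zero EllTwo 2 μ] with x hx i _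
    rw [hx]
    rfl
  add_mem' := by
    intro f g hf hg
    filter_upwards [hf, hg, Lp.coeFn_add f g] with x h1 h2 h3 i hi
    rw [h3]
    change (f x) i + (g x) i = 0
    rw [h1 i hi, h2 i hi, add_zero]
  smul_mem' := by
    intro c f hf
    filter_upwards [hf, Lp.coeFn_smul c f] with x h1 h2 i hi
    rw [h2]
    change c • (f x) i = 0
    rw [h1 i hi, smul_zero]

/-- `m` is a multiplicity function of the representation `ρ` on the subspace `K`: `K` is invariant
under `ρ`, and some unitary from `K` onto `L²(X, m, μ)` carries each `ρ(g)` to multiplication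
by `g`. -/
def IsMultiplicityFunction {μ : Measure X} (ρ : Lp ℂ ∞ μ →ₗ[ℂ] (H →L[ℂ] H)) (K : Submodule ℂ H)
    (m : X → ℕ∞) : Prop :=
  AEMeasurable m μ ∧ ∃ hK : ∀ g : Lp ℂ ∞ μ, ∀ v ∈ K, ρ g v ∈ K,
    ∃ J : K ≃ₗᵢ[ℂ] LTwoMult μ m, ∀ (g : Lp ℂ ∞ μ) (v : K),
      ((J ⟨ρ g v, hK g v v.2⟩ : Lp EllTwo 2 μ) : X → EllTwo) =ᵐ[μ]
        fun x => g x • ((J v : Lp EllTwo 2 μ) : X → EllTwo) x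

end Representations

section Dilation

variable {X : Type*} [MeasurableSpace X] {μ : Measure X} [IsFiniteMeasure μ] {r : X → X}
variable {H : Type*} [NormedAddCommGroup H] [InnerProductSpace ℂ H] [CompleteSpace H]
variable {H' : Type*} [NormedAddCommGroup H'] [InnerProductSpace ℂ H'] [CompleteSpace H']

/-- The covariance relation `S π(g) = π(g ∘ r) S` for all `g ∈ L^∞`. -/
def IsCovariant (hr : MeasurePreserving r μ μ) (S : H →ₗᵢ[ℂ] H)
    (π : Lp ℂ ∞ μ →ₗ[ℂ] (H →L[ℂ] H)) : Prop :=
  ∀ (g : Lp ℂ ∞ μ) (ξ : H), S (π g ξ) = π (Lp.compMeasurePreserving r hr g) (S ξ)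

/-- `(H', S', π')`, with `H` embedded isometrically in `H'` by `ι`, is the covariant dilation of
`(H, S, π)`: `S'` is a unitary extending `S`, the subspaces `S'⁻ⁿ H` have dense union, `π'` is a
representation extending `π`, and `S' π'(g) = π'(g ∘ r) S'`. -/
structure IsCovariantDilation (hr : MeasurePreserving r μ μ) (S : H →ₗᵢ[ℂ] H)
    (π : Lp ℂ ∞ μ →ₗ[ℂ] (H →L[ℂ] H)) (ι : H →ₗᵢ[ℂ] H') (S' : H' ≃ₗᵢ[ℂ] H')
    (π' : Lp ℂ ∞ μ →ₗ[ℂ] (H' →L[ℂ] H')) : Prop where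
  extends_isometry : ∀ ξ : H, S' (ι ξ) = ι (S ξ)
  dense_union : Dense (⋃ n : ℕ, (S'.symm)^[n] '' Set.range ι)
  isRepresentation : IsRepresentation π'
  extends_rep : ∀ (g : Lp ℂ ∞ μ) (ξ : H), π' g (ι ξ) = ι (π g ξ)
  covariant : IsCovariant hr S'.toLinearIsometry π'

/-- `V₀ = H`, as a subspace of the dilation space. -/
def spaceV0 (ι : H →ₗᵢ[ℂ] H') : Submodule ℂ H' := LinearMap.range ι.toLinearMap

/-- `V₁ = S'⁻¹ H`. -/
def spaceV1 (ι : H →ₗᵢ[ℂ] H') (S' : H' ≃ₗᵢ[ℂ] H') : Submodule ℂ H' :=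
  (spaceV0 ι).map (S'.symm.toLinearEquiv : H' →ₗ[ℂ] H')

/-- `W₀ = V₁ ⊖ V₀`. -/
def spaceW0 (ι : H →ₗᵢ[ℂ] H') (S' : H' ≃ₗᵢ[ℂ] H') : Submodule ℂ H' :=
  spaceV1 ι S' ⊓ (spaceV0 ι)ᗮ

end Dilation

end MultiplicityDilation

end

/-! Everything is reduced to counting densities. Suppose an invariant subspace `K` is an orthogonal
sum of cyclic subspaces generated by countably many vectors `ξ i`, and the functional `g ↦ ⟪ξ i, ρ g
(ξ i)⟫` is integration against `w i ≥ 0`. The unitary class of `ρ` on `K` depends only on the `w i`,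
because they determine the Gram matrix of the vectors `ρ g (ξ i)`. Packing the indices active at `x`
into the first coordinates of `ℓ²` shows that `x ↦ #{i | w i x ≠ 0}` is a multiplicity function. Any
two multiplicity functions agree a.e., since an isometry of modules preserves inner products
pointwise and `ℂⁿ` has no `n + 1` orthonormal vectors. Counting also makes multiplicity additive
over orthogonal sums.

The unitary `S'` identifies `π' g` on `V₁` with `π' (g ∘ r)` on `V₀`, so `V₁` is `L²(X, m, μ)`, `m =
m_{V₀}`, with `g` acting as multiplication by `g ∘ r`. Up to a null set, `X` splits into measurable
sets `D k` on which `r` is injective. The vectors `1_{D k ∩ {j < m}} e_j` are then an orthogonal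
system for the new action. By strong invariance the density belonging to `1_A` is the proportion of
the fibre over `x` lying in `A`, which is nonzero exactly on `r '' A`. Counting the pairs `(j, k)`
with `x ∈ r '' (D k ∩ {j < m})` gives `∑_{r(y)=x} m(y)`, which is (i); additivity over `V₁ = V₀ ⊕
W₀` gives (ii).

The main lemmas are `IsOrthogonalSystem.isMultiplicityFunction`, `IsMultiplicityFunction.ae_eq`,
`IsStronglyInvariant.exists_partition` and `IsStronglyInvariant.exists_fibreSystem`. -/

noncomputable section

namespace MultiplicityDilation

/-! ### Unitaries from equal Gram matrices -/

section Gram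

variable {E F A : Type*} [NormedAddCommGroup E] [InnerProductSpace ℂ E] [CompleteSpace E]
  [NormedAddCommGroup F] [InnerProductSpace ℂ F] [CompleteSpace F]

theorem dense_range_linearCombination {v : A → E}
    (hv : ∀ x : E, (∀ a, inner ℂ (v a) x = 0) → x = 0) :
    DenseRange (Finsupp.linearCombination ℂ v) := by
  have h : (LinearMap.range (Finsupp.linearCombination ℂ v)).topologicalClosure = ⊤ := by
    rw [Submodule.topologicalClosure_eq_top_iff, Submodule.eq_bot_iff]
    intro x hx
    refine hv x fun a => ?_
    exact hx _ ⟨Finsupp.single a 1, by simp⟩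
  exact (Submodule.dense_iff_topologicalClosure_eq_top).2 h

/-- Two total families with the same Gram matrix are carried to each other by a unitary. -/
theorem exists_linearIsometryEquiv_of_gram_eq (v : A → E) (u : A → F)
    (huv : ∀ a b, inner ℂ (v a) (v b) = inner ℂ (u a) (u b))
    (hv : ∀ x : E, (∀ a, inner ℂ (v a) x = 0) → x = 0)
    (hu : ∀ x : F, (∀ a, inner ℂ (u a) x = 0) → x = 0) :
    ∃ J : E ≃ₗᵢ[ℂ] F, ∀ a, J (v a) = u a := by
  have hdv := dense_range_linearCombination hv
  have hdu := dense_range_linearCombination hu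
  set V := Finsupp.linearCombination ℂ v
  set U := Finsupp.linearCombination ℂ u
  have hnorm : ∀ c, ‖U c‖ = ‖V c‖ := by
    intro c
    have h : inner ℂ (U c) (U c) = inner ℂ (V c) (V c) := by
      simp only [U, V, Finsupp.linearCombination_apply, Finsupp.sum_inner, Finsupp.inner_sum,
        inner_smul_left, inner_smul_right, huv]
    rw [@norm_eq_sqrt_re_inner ℂ, @norm_eq_sqrt_re_inner ℂ, h]
  have hex : ∃ C, ∀ c, ‖U c‖ ≤ C * ‖V c‖ := ⟨1, fun c => by rw [one_mul, hnorm]⟩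
  -- Since `U c` and `V c` have equal norms, `V c ↦ U c` is well defined and extends from the dense
  -- range of `V`.
  let T := U.extendOfNorm V
  have hT : ∀ c, T (V c) = U c := fun c => LinearMap.extendOfNorm_eq hdv hex c
  have hTn : ∀ x, ‖T x‖ = ‖x‖ := by
    intro x
    refine hdv.induction_on (p := fun x => ‖T x‖ = ‖x‖) x
      (isClosed_eq (by fun_prop) (by fun_prop)) fun c => ?_
    rw [hT, hnorm]
  let L : E →ₗᵢ[ℂ] F := ⟨T.toLinearMap, hTn⟩
  have hsurj : Function.Surjective L := by
    have hc : IsClosed (Set.range L) := L.isometry.isClosedEmbedding.isClosed_range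
    have hd : DenseRange L := by
      refine hdu.mono ?_
      rintro _ ⟨c, rfl⟩
      exact ⟨V c, hT c⟩
    intro y
    have := hd y
    rwa [hc.closure_eq] at this
  refine ⟨LinearIsometryEquiv.ofSurjective L hsurj, fun a => ?_⟩
  have := hT (Finsupp.single a 1)
  change T (v a) = u a
  simpa [U, V] using this

end Gram

/-! ### Orthogonal systems of cyclic vectors and their densities -/

section Systems

variable {X : Type*} [MeasurableSpace X] {μ : Measure X}
variable {H : Type*} [NormedAddCommGroup H] [InnerProductSpace ℂ H]
variable {H₂ : Type*} [NormedAddCommGroup H₂] [InnerProductSpace ℂ H₂]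

/-- The vectors `ξ i` of the invariant subspace `K` have mutually orthogonal cyclic subspaces,
which span `K`, and the spectral measure of `ξ i` has density `w i`. -/
structure IsOrthogonalSystem {I : Type*} (ρ : Lp ℂ ∞ μ →ₗ[ℂ] (H →L[ℂ] H)) (K : Submodule ℂ H)
    (ξ : I → H) (w : I → X → ℝ) : Prop where
  mem : ∀ i, ξ i ∈ K
  measurable : ∀ i, Measurable (w i)
  nonneg : ∀ i x, 0 ≤ w i x
  integrable : ∀ i, Integrable (w i) μ
  inner_self : ∀ i g, inner ℂ (ξ i) (ρ g (ξ i)) = ∫ x, g x * (w i x : ℂ) ∂μ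
  inner_ne : ∀ i j, i ≠ j → ∀ g, inner ℂ (ξ i) (ρ g (ξ j)) = 0
  total : ∀ v ∈ K, (∀ i g, inner ℂ (ρ g (ξ i)) v = 0) → v = 0

theorem IsOrthogonalSystem.comp_equiv {I I' : Type*} {ρ : Lp ℂ ∞ μ →ₗ[ℂ] (H →L[ℂ] H)}
    {K : Submodule ℂ H} {ξ : I → H} {w : I → X → ℝ} (h : IsOrthogonalSystem ρ K ξ w)
    (e : I' ≃ I) : IsOrthogonalSystem ρ K (ξ ∘ e) (w ∘ e) where
  mem i := h.mem _
  measurable i := h.measurable _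
  nonneg i := h.nonneg _
  integrable i := h.integrable _
  inner_self i := h.inner_self _
  inner_ne i j hij := h.inner_ne _ _ fun he => hij (e.injective he)
  total v hv H := h.total v hv fun i g => by simpa using H (e.symm i) g

variable [CompleteSpace H] [CompleteSpace H₂] [IsFiniteMeasure μ]

theorem IsRepresentation.inner_left {ρ : Lp ℂ ∞ μ →ₗ[ℂ] (H →L[ℂ] H)} (hρ : IsRepresentation ρ)
    (g : Lp ℂ ∞ μ) (u v : H) : inner ℂ (ρ g u) v = inner ℂ u (ρ (star g) v) := by
  rw [hρ.map_star, ContinuousLinearMap.adjoint_inner_right]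

theorem IsRepresentation.mul_apply {ρ : Lp ℂ ∞ μ →ₗ[ℂ] (H →L[ℂ] H)} (hρ : IsRepresentation ρ)
    (f g : Lp ℂ ∞ μ) (u : H) : ρ f (ρ g u) = ρ (f • g : Lp ℂ ∞ μ) u := by
  rw [hρ.map_mul]; rfl

theorem IsRepresentation.inner_apply_apply {ρ : Lp ℂ ∞ μ →ₗ[ℂ] (H →L[ℂ] H)}
    (hρ : IsRepresentation ρ) (f g : Lp ℂ ∞ μ) (u v : H) :
    inner ℂ (ρ f u) (ρ g v) = inner ℂ u (ρ (star f • g : Lp ℂ ∞ μ) v) := by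
  rw [hρ.inner_left, hρ.mul_apply]

theorem IsRepresentation.one_apply {ρ : Lp ℂ ∞ μ →ₗ[ℂ] (H →L[ℂ] H)} (hρ : IsRepresentation ρ)
    (u : H) : ρ (Lp.const ∞ μ (1 : ℂ)) u = u := by
  rw [hρ.map_one]; rfl

/-- Orthogonal systems with the same densities give unitarily equivalent representations. -/
theorem IsOrthogonalSystem.exists_equiv {I : Type*}
    {ρ : Lp ℂ ∞ μ →ₗ[ℂ] (H →L[ℂ] H)} {K : Submodule ℂ H} {ξ : I → H} {w : I → X → ℝ}
    {ρ₂ : Lp ℂ ∞ μ →ₗ[ℂ] (H₂ →L[ℂ] H₂)} {K₂ : Submodule ℂ H₂} {ξ₂ : I → H₂}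
    (h : IsOrthogonalSystem ρ K ξ w) (h₂ : IsOrthogonalSystem ρ₂ K₂ ξ₂ w)
    (hρ : IsRepresentation ρ) (hρ₂ : IsRepresentation ρ₂)
    (hc : IsClosed (K : Set H)) (hc₂ : IsClosed (K₂ : Set H₂))
    (hK : ∀ g, ∀ v ∈ K, ρ g v ∈ K) (hK₂ : ∀ g, ∀ v ∈ K₂, ρ₂ g v ∈ K₂) :
    ∃ J : K ≃ₗᵢ[ℂ] K₂, ∀ (g : Lp ℂ ∞ μ) (v : K),
      (J ⟨ρ g v, hK g v v.2⟩ : H₂) = ρ₂ g (J v) := by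
  have : CompleteSpace K := hc.completeSpace_coe
  have : CompleteSpace K₂ := hc₂.completeSpace_coe
  let v : I × Lp ℂ ∞ μ → K := fun a => ⟨ρ a.2 (ξ a.1), hK _ _ (h.mem _)⟩
  let u : I × Lp ℂ ∞ μ → K₂ := fun a => ⟨ρ₂ a.2 (ξ₂ a.1), hK₂ _ _ (h₂.mem _)⟩
  have hv : ∀ x : K, (∀ a, inner ℂ (v a) x = 0) → x = 0 := fun x hx =>
    Subtype.ext (h.total x x.2 fun i g => hx (i, g))
  have hu : ∀ x : K₂, (∀ a, inner ℂ (u a) x = 0) → x = 0 := fun x hx =>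
    Subtype.ext (h₂.total x x.2 fun i g => hx (i, g))
  obtain ⟨J, hJ⟩ := exists_linearIsometryEquiv_of_gram_eq v u (by
    rintro ⟨i, f⟩ ⟨j, g⟩
    simp only [v, u, Submodule.coe_inner]
    rw [hρ.inner_apply_apply, hρ₂.inner_apply_apply]
    by_cases hij : i = j
    · subst hij
      rw [h.inner_self, h₂.inner_self]
    · rw [h.inner_ne _ _ hij, h₂.inner_ne _ _ hij]) hv hu
  refine ⟨J, fun g x => ?_⟩
  -- The intertwining relation is a closed condition, so it suffices to check it on combinations of
  -- the generators `ρ f (ξ i)`.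
  let R : K →L[ℂ] K := ((ρ g).comp K.subtypeL).codRestrict K fun x => hK g x x.2
  have hd := dense_range_linearCombination hv
  have hR : ∀ x : K, (J (R x) : H₂) = ρ₂ g (J x) := by
    intro x
    refine hd.induction_on (p := fun x => (J (R x) : H₂) = ρ₂ g (J x)) x
      (isClosed_eq (by fun_prop) (by fun_prop)) fun c => ?_
    induction c using Finsupp.induction_linear with
    | zero => simp
    | add c d hc hd => simp only [map_add, Submodule.coe_add, hc, hd]
    | single a z =>
      have h1 : R (v a) = v (a.1, (g • a.2 : Lp ℂ ∞ μ)) := by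
        ext
        exact hρ.mul_apply _ _ _
      simp only [Finsupp.linearCombination_single, map_smul, Submodule.coe_smul, h1, hJ]
      congr 1
      exact (hρ₂.mul_apply _ _ _).symm
  exact hR x

end Systems

/-! ### The multiplication representation on `L²(X, m, μ)` -/

section Model

variable {X : Type*} [MeasurableSpace X] {μ : Measure X}

/-- The coordinate vectors of `ℓ²(ℕ)`. -/
def coordVec (k : ℕ) : EllTwo := lp.single 2 k (1 : ℂ)

theorem inner_coordVec (k : ℕ) (f : EllTwo) : inner ℂ (coordVec k) f = f k := by
  simp [coordVec, lp.inner_single_left]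

theorem coordVec_self (k : ℕ) : coordVec k k = 1 := by
  simp [coordVec]

theorem coordVec_ne {k j : ℕ} (h : j ≠ k) : coordVec k j = 0 := by
  simp [coordVec, h]

theorem norm_coordVec (k : ℕ) : ‖coordVec k‖ = 1 := by
  rw [coordVec, lp.norm_single (by norm_num)]; simp

/-- `L^∞` acting on `L²(X; ℓ²)` by multiplication. -/
def mulRep (μ : Measure X) : Lp ℂ ∞ μ →ₗ[ℂ] (Lp EllTwo 2 μ →L[ℂ] Lp EllTwo 2 μ) :=
  ((ContinuousLinearMap.lsmul ℂ ℂ : ℂ →L[ℂ] EllTwo →L[ℂ] EllTwo).holderL μ ∞ 2 2).toLinearMap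

theorem coeFn_mulRep (g : Lp ℂ ∞ μ) (f : Lp EllTwo 2 μ) :
    (mulRep μ g f : X → EllTwo) =ᵐ[μ] fun x => g x • f x :=
  ContinuousLinearMap.coeFn_holder _ g f

theorem inner_mulRep (g : Lp ℂ ∞ μ) (f f' : Lp EllTwo 2 μ) :
    inner ℂ f (mulRep μ g f') = ∫ x, g x * inner ℂ (f x) (f' x) ∂μ := by
  rw [L2.inner_def]
  refine integral_congr_ae ?_
  filter_upwards [coeFn_mulRep g f'] with x hx
  rw [hx, inner_smul_right]

theorem isRepresentation_mulRep [IsFiniteMeasure μ] : IsRepresentation (mulRep μ) where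
  map_one := by
    ext1 f
    refine Lp.ext ?_
    filter_upwards [coeFn_mulRep (Lp.const ∞ μ (1 : ℂ)) f, Lp.coeFn_const ∞ μ (1 : ℂ)]
      with x h1 h2
    rw [h1, h2]
    simp
  map_mul f g := by
    ext1 u
    refine Lp.ext ?_
    filter_upwards [coeFn_mulRep (f • g : Lp ℂ ∞ μ) u, coeFn_mulRep f (mulRep μ g u),
      coeFn_mulRep g u, Lp.coeFn_lpSMul (r := ∞) f g] with x h1 h2 h3 h4
    rw [h1, ContinuousLinearMap.comp_apply, h2, h3, h4]
    simp [mul_smul]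
  map_star f := by
    rw [ContinuousLinearMap.eq_adjoint_iff]
    intro u v
    rw [L2.inner_def, inner_mulRep]
    refine integral_congr_ae ?_
    filter_upwards [coeFn_mulRep (star f) u, Lp.coeFn_star f] with x h1 h2
    rw [h1, h2, inner_smul_left]
    simp

/-- The indicator function of a measurable set, as an element of `L^∞`. -/
def indLp (μ : Measure X) [IsFiniteMeasure μ] {s : Set X} (hs : MeasurableSet s) : Lp ℂ ∞ μ :=
  indicatorConstLp ∞ hs (measure_ne_top μ s) (1 : ℂ)

theorem coeFn_indLp [IsFiniteMeasure μ] {s : Set X} (hs : MeasurableSet s) :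
    (indLp μ hs : X → ℂ) =ᵐ[μ] s.indicator fun _ => 1 :=
  indicatorConstLp_coeFn

theorem integral_indLp_mul [IsFiniteMeasure μ] {s : Set X} (hs : MeasurableSet s) (u : X → ℂ) :
    ∫ x, indLp μ hs x * u x ∂μ = ∫ x in s, u x ∂μ := by
  rw [← integral_indicator hs]
  refine integral_congr_ae ?_
  filter_upwards [coeFn_indLp (μ := μ) hs] with x hx
  rw [hx]
  by_cases hxs : x ∈ s <;> simp [hxs]

theorem star_indLp_smul [IsFiniteMeasure μ] {s : Set X} (hs : MeasurableSet s) :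
    (star (indLp μ hs) • indLp μ hs : Lp ℂ ∞ μ) = indLp μ hs := by
  refine Lp.ext ?_
  filter_upwards [Lp.coeFn_lpSMul (r := ∞) (star (indLp μ hs)) (indLp μ hs),
    Lp.coeFn_star (indLp μ hs), coeFn_indLp (μ := μ) hs] with x h1 h2 h3
  rw [h1, Pi.smul_apply', h2, Pi.star_apply, h3]
  by_cases hxs : x ∈ s <;> simp [hxs]

theorem ae_eq_of_forall_integral_mul_eq [IsFiniteMeasure μ] {u v : X → ℂ} (hu : Integrable u μ)
    (hv : Integrable v μ) (h : ∀ g : Lp ℂ ∞ μ, ∫ x, g x * u x ∂μ = ∫ x, g x * v x ∂μ) :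
    u =ᵐ[μ] v := by
  refine Integrable.ae_eq_of_forall_setIntegral_eq u v hu hv fun s hs _ => ?_
  rw [← integral_indLp_mul hs, ← integral_indLp_mul hs, h]

theorem integrable_inner_coeFn (f f' : Lp EllTwo 2 μ) :
    Integrable (fun x => (inner ℂ (f x) (f' x) : ℂ)) μ :=
  L2.integrable_inner f f'

/-- An `L²`-convergent sequence has a subsequence converging a.e., and coordinates of `ℓ²` are
continuous. -/
theorem isClosed_LTwoMult (m : X → ℕ∞) : IsClosed (LTwoMult μ m : Set (Lp EllTwo 2 μ)) := by
  refine isClosed_of_closure_subset fun f hf => ?_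
  obtain ⟨s, hs, hlim⟩ := mem_closure_iff_seq_limit.1 hf
  obtain ⟨n, -, hn⟩ := (tendstoInMeasure_of_tendsto_Lp hlim).exists_seq_tendsto_ae
  have hall : ∀ᵐ x ∂μ, ∀ k, ∀ i : ℕ, m x ≤ (i : ℕ∞) → (s k x) i = 0 := ae_all_iff.2 hs
  change ∀ᵐ x ∂μ, ∀ i : ℕ, m x ≤ (i : ℕ∞) → (f x) i = 0
  filter_upwards [hn, hall] with x h1 h2 i hi
  have h3 : Filter.Tendsto (fun k => inner ℂ (coordVec i) (s (n k) x)) Filter.atTop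
      (nhds (inner ℂ (coordVec i) (f x))) := by
    exact (Continuous.tendsto (by fun_prop) (f x)).comp h1
  simp only [inner_coordVec, h2 _ i hi] at h3
  exact tendsto_nhds_unique h3 tendsto_const_nhds

theorem mulRep_mem_LTwoMult {m : X → ℕ∞} (g : Lp ℂ ∞ μ) :
    ∀ v ∈ LTwoMult μ m, mulRep μ g v ∈ LTwoMult μ m := by
  intro v hv
  change ∀ᵐ x ∂μ, ∀ i : ℕ, m x ≤ (i : ℕ∞) → (mulRep μ g v x) i = 0
  filter_upwards [hv, coeFn_mulRep g v] with x h1 h2 i hi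
  rw [h2]
  change g x • (v x) i = 0
  rw [h1 i hi, smul_zero]

/-- The pointwise squared norm is `w`. The coordinate `p x` may vary with `x`, which lets a system
be packed into the first `m x` coordinates. -/
theorem memLp_weight {w : X → ℝ} {p : X → ℕ} (hw : Measurable w) (h0 : ∀ x, 0 ≤ w x)
    (hi : Integrable w μ) (hp : Measurable p) :
    MemLp (fun x => ((√(w x) : ℝ) : ℂ) • coordVec (p x)) 2 μ := by
  have hm : StronglyMeasurable (fun x => coordVec (p x)) :=
    (StronglyMeasurable.of_discrete (f := coordVec)).comp_measurable hp
  have hs : StronglyMeasurable (fun x => ((√(w x) : ℝ) : ℂ)) :=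
    (by fun_prop : Measurable _).stronglyMeasurable
  have hsm : AEStronglyMeasurable (fun x => ((√(w x) : ℝ) : ℂ) • coordVec (p x)) μ :=
    (hs.smul hm).aestronglyMeasurable
  rw [memLp_two_iff_integrable_sq_norm hsm]
  refine hi.congr (Filter.Eventually.of_forall fun x => ?_)
  change w x = ‖((√(w x) : ℝ) : ℂ) • coordVec (p x)‖ ^ 2
  rw [norm_smul, norm_coordVec, mul_one, Complex.norm_real, Real.norm_eq_abs, sq_abs,
    Real.sq_sqrt (h0 x)]

theorem inner_weight {a b : ℝ} {j k : ℕ} :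
    (inner ℂ (((√a : ℝ) : ℂ) • coordVec j) (((√b : ℝ) : ℂ) • coordVec k) : ℂ) =
      if j = k then ((√a * √b : ℝ) : ℂ) else 0 := by
  rw [inner_smul_left, inner_smul_right, inner_coordVec]
  split_ifs with h
  · subst h; simp [coordVec_self]
  · simp [coordVec_ne h]

/-- The model of an orthogonal system with densities `w i` inside `L²(X, m, μ)`. -/
theorem isOrthogonalSystem_model [IsFiniteMeasure μ] {I : Type*} [Countable I]
    {w : I → X → ℝ} {p : I → X → ℕ}
    {m : X → ℕ∞} (hw : ∀ i, Measurable (w i)) (h0 : ∀ i x, 0 ≤ w i x)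
    (hi : ∀ i, Integrable (w i) μ) (hp : ∀ i, Measurable (p i))
    (hinj : ∀ x i j, w i x ≠ 0 → w j x ≠ 0 → p i x = p j x → i = j)
    (hm : ∀ᵐ x ∂μ, ∀ k : ℕ, (k : ℕ∞) < m x ↔ ∃ i, w i x ≠ 0 ∧ p i x = k) :
    IsOrthogonalSystem (mulRep μ) (LTwoMult μ m)
      (fun i => (memLp_weight (hw i) (h0 i) (hi i) (hp i)).toLp) w where
  mem i := by
    change ∀ᵐ x ∂μ, ∀ k : ℕ, m x ≤ (k : ℕ∞) → (MemLp.toLp _ _ : X → EllTwo) x k = 0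
    filter_upwards [(memLp_weight (hw i) (h0 i) (hi i) (hp i)).coeFn_toLp, hm] with x h1 h2 k hk
    rw [h1]
    change ((√(w i x) : ℝ) : ℂ) • (coordVec (p i x) k) = 0
    by_cases hwx : w i x = 0
    · simp [hwx]
    · rw [coordVec_ne, smul_zero]
      intro hkp
      exact absurd ((h2 k).2 ⟨i, hwx, hkp.symm⟩) (not_lt.2 hk)
  measurable := hw
  nonneg := h0
  integrable := hi
  inner_self i g := by
    rw [inner_mulRep]
    refine integral_congr_ae ?_
    filter_upwards [(memLp_weight (hw i) (h0 i) (hi i) (hp i)).coeFn_toLp] with x h1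
    rw [h1, inner_weight, if_pos rfl, Real.mul_self_sqrt (h0 i x)]
  inner_ne i j hij g := by
    rw [inner_mulRep]
    refine integral_eq_zero_of_ae ?_
    filter_upwards [(memLp_weight (hw i) (h0 i) (hi i) (hp i)).coeFn_toLp,
      (memLp_weight (hw j) (h0 j) (hi j) (hp j)).coeFn_toLp] with x h1 h2
    rw [h1, h2, inner_weight]
    split_ifs with h
    · by_cases hwi : w i x = 0
      · simp [hwi]
      by_cases hwj : w j x = 0
      · simp [hwj]
      exact absurd (hinj x i j hwi hwj h) hij
    · simp
  total v hv h := by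
    -- Orthogonality to all multiples by `g` forces pointwise orthogonality; by `hm` every
    -- coordinate below `m x` is then tested by some active index.
    have hz : ∀ i, (fun x => (inner ℂ ((memLp_weight (hw i) (h0 i) (hi i) (hp i)).toLp _ x)
        (v x) : ℂ)) =ᵐ[μ] fun _ => 0 := by
      intro i
      refine ae_eq_of_forall_integral_mul_eq (integrable_inner_coeFn _ _) (integrable_zero _ _ _)
        fun g => ?_
      have := h i (star g)
      rw [isRepresentation_mulRep.inner_left, star_star, inner_mulRep] at this
      rw [this]; simp
    refine Lp.ext ?_
    have h1 := ae_all_iff.2 fun i => (memLp_weight (hw i) (h0 i) (hi i) (hp i)).coeFn_toLp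
    filter_upwards [ae_all_iff.2 hz, h1, hv, hm, Lp.coeFn_zero EllTwo 2 μ] with x h2 h3 h4 h5 h6
    rw [h6]
    ext k
    change v x k = 0
    by_cases hk : (k : ℕ∞) < m x
    · obtain ⟨i, hwi, rfl⟩ := (h5 k).1 hk
      have := h2 i
      rw [h3, inner_smul_left, inner_coordVec] at this
      have hs : (√(w i x) : ℝ) ≠ 0 := (Real.sqrt_pos.2 ((h0 i x).lt_of_ne' hwi)).ne'
      simpa [hs] using this
    · exact h4 k (not_lt.1 hk)

end Model

/-! ### The level sets of a multiplicity function -/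

section Levels

variable {X : Type*}

/-- The densities `1_{i < m}`. -/
def levelWeight (m : X → ℕ∞) (i : ℕ) : X → ℝ := {x | (i : ℕ∞) < m x}.indicator 1

theorem levelWeight_ne_zero {m : X → ℕ∞} {i : ℕ} {x : X} :
    levelWeight m i x ≠ 0 ↔ (i : ℕ∞) < m x := by
  simp [levelWeight]

theorem levelWeight_nonneg (m : X → ℕ∞) (i : ℕ) (x : X) : 0 ≤ levelWeight m i x :=
  Set.indicator_nonneg (by simp) x

theorem encard_natCast_lt (a : ℕ∞) : {i : ℕ | (i : ℕ∞) < a}.encard = a := by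
  induction a using ENat.recTopCoe with
  | top => simp
  | coe k =>
    have : {i : ℕ | (i : ℕ∞) < k} = (Finset.range k : Set ℕ) := by ext; simp
    rw [this, Set.encard_coe_eq_coe_finsetCard, Finset.card_range]

theorem encard_levelWeight (m : X → ℕ∞) (x : X) : {i | levelWeight m i x ≠ 0}.encard = m x := by
  simp only [levelWeight_ne_zero, encard_natCast_lt]

variable [MeasurableSpace X] {μ : Measure X}

theorem measurable_levelWeight {m : X → ℕ∞} (hm : Measurable m) (i : ℕ) :
    Measurable (levelWeight m i) :=
  measurable_const.indicator (hm (MeasurableSet.of_discrete (s := Set.Ioi (i : ℕ∞))))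

theorem integrable_levelWeight [IsFiniteMeasure μ] {m : X → ℕ∞} (hm : Measurable m) (i : ℕ) :
    Integrable (levelWeight m i) μ :=
  (integrable_const (1 : ℝ)).indicator (hm (MeasurableSet.of_discrete (s := Set.Ioi (i : ℕ∞))))

end Levels

/-! ### Multiplicity counts the nonzero densities; uniqueness -/

section Multiplicity

variable {X : Type*} [MeasurableSpace X] {μ : Measure X}
variable {H : Type*} [NormedAddCommGroup H] [InnerProductSpace ℂ H]
variable {H₂ : Type*} [NormedAddCommGroup H₂] [InnerProductSpace ℂ H₂]

/-- `Nat.count P i` is the rank of `i` among the indices satisfying `P`, so the ranks fill an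
initial segment of `ℕ` without gaps. -/
theorem lt_encard_iff_exists_count (P : ℕ → Prop) [DecidablePred P] (k : ℕ) :
    (k : ℕ∞) < {i | P i}.encard ↔ ∃ i, P i ∧ Nat.count P i = k := by
  constructor
  · intro h
    have hk : ∀ hf : (Set.ofPred P).Finite, k < hf.toFinset.card := by
      intro hf
      rw [hf.encard_eq_coe_toFinset_card] at h
      exact_mod_cast h
    exact ⟨Nat.nth P k, Nat.nth_mem k hk, Nat.count_nth hk⟩
  · rintro ⟨i, hi, rfl⟩
    by_cases hf : (Set.ofPred P).Finite
    · have := Nat.count_lt_card hf hi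
      rw [hf.encard_eq_coe_toFinset_card]
      exact_mod_cast this
    · rw [Set.encard_eq_top_iff.2 hf]
      exact ENat.natCast_lt_top _

theorem IsOrthogonalSystem.of_equiv {I : Type*}
    {ρ : Lp ℂ ∞ μ →ₗ[ℂ] (H →L[ℂ] H)} {K : Submodule ℂ H} {w : I → X → ℝ}
    {ρ₂ : Lp ℂ ∞ μ →ₗ[ℂ] (H₂ →L[ℂ] H₂)} {K₂ : Submodule ℂ H₂} {ξ : I → H₂}
    (h : IsOrthogonalSystem ρ₂ K₂ ξ w) (hK : ∀ g, ∀ v ∈ K, ρ g v ∈ K)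
    (J : K ≃ₗᵢ[ℂ] K₂) (hJ : ∀ (g : Lp ℂ ∞ μ) (v : K),
      (J ⟨ρ g v, hK g v v.2⟩ : H₂) = ρ₂ g (J v)) :
    IsOrthogonalSystem ρ K (fun i => (J.symm ⟨ξ i, h.mem i⟩ : H)) w := by
  have key : ∀ i g, J ⟨ρ g (J.symm ⟨ξ i, h.mem i⟩), hK g _ (Subtype.mem _)⟩ = ρ₂ g (ξ i) := by
    intro i g
    rw [hJ, LinearIsometryEquiv.apply_symm_apply]
  have hin : ∀ i j g, inner ℂ (J.symm ⟨ξ i, h.mem i⟩ : H) (ρ g (J.symm ⟨ξ j, h.mem j⟩ : H)) =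
      inner ℂ (ξ i) (ρ₂ g (ξ j)) := by
    intro i j g
    have h1 := J.inner_map_map (J.symm ⟨ξ i, h.mem i⟩)
      ⟨ρ g (J.symm ⟨ξ j, h.mem j⟩), hK g _ (Subtype.mem _)⟩
    rw [Submodule.coe_inner, Submodule.coe_inner, key, LinearIsometryEquiv.apply_symm_apply] at h1
    exact h1.symm
  refine ⟨fun i => Subtype.mem _, h.measurable, h.nonneg, h.integrable, fun i g => ?_,
    fun i j hij g => ?_, fun v hv hz => ?_⟩
  · rw [hin, h.inner_self]
  · rw [hin, h.inner_ne _ _ hij]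
  · have : (J ⟨v, hv⟩ : H₂) = 0 := by
      refine h.total _ (Subtype.mem _) fun i g => ?_
      rw [← key, ← Submodule.coe_inner, J.inner_map_map, Submodule.coe_inner]
      exact hz i g
    have h2 : J ⟨v, hv⟩ = 0 := Subtype.ext this
    have h3 := (map_eq_zero_iff J J.injective).1 h2
    exact congrArg Subtype.val h3

theorem measurable_of_lt_iff {m : X → ℕ∞} (h : ∀ k : ℕ, MeasurableSet {x | (k : ℕ∞) < m x}) :
    Measurable m := by
  refine ENat.measurable_iff.2 fun n => ?_
  have : m ⁻¹' {(n : ℕ∞)} = {x | (n : ℕ∞) < m x}ᶜ ∩ ⋂ k : Fin n, {x | ((k : ℕ) : ℕ∞) < m x} := by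
    ext x
    simp only [Set.mem_preimage, Set.mem_singleton_iff, Set.mem_inter_iff, Set.mem_compl_iff,
      Set.mem_ofPred_eq, not_lt, Set.mem_iInter]
    constructor
    · intro hx
      exact ⟨hx.le, fun k => by rw [hx]; exact_mod_cast k.2⟩
    · rintro ⟨h1, h2⟩
      obtain ⟨j, hj⟩ := ENat.ne_top_iff_exists.1 (ne_top_of_le_ne_top (ENat.natCast_ne_top n) h1)
      rw [← hj] at h1 h2 ⊢
      have h1' : j ≤ n := by exact_mod_cast h1
      by_contra hne
      have hjn : j < n := lt_of_le_of_ne h1' fun e => hne (by rw [e])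
      exact lt_irrefl _ (h2 ⟨j, hjn⟩)
  rw [this]
  exact (h n).compl.inter (MeasurableSet.iInter fun k => h k)

theorem IsMultiplicityFunction.exists_equiv {ρ : Lp ℂ ∞ μ →ₗ[ℂ] (H →L[ℂ] H)} {K : Submodule ℂ H}
    {m : X → ℕ∞} (h : IsMultiplicityFunction ρ K m) :
    ∃ hK : ∀ g : Lp ℂ ∞ μ, ∀ v ∈ K, ρ g v ∈ K, ∃ J : K ≃ₗᵢ[ℂ] LTwoMult μ m,
      ∀ (g : Lp ℂ ∞ μ) (v : K), (J ⟨ρ g v, hK g v v.2⟩ : Lp EllTwo 2 μ) = mulRep μ g (J v) := by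
  obtain ⟨-, hK, J, hJ⟩ := h
  exact ⟨hK, J, fun g v => Lp.ext ((hJ g v).trans (coeFn_mulRep g _).symm)⟩

variable [IsFiniteMeasure μ]

/-- The model vectors `1_{i < m'} e_i` are pulled back to `K`; a measurable representative `m'` is
needed because `m` is only a.e. measurable. -/
theorem IsMultiplicityFunction.exists_system {ρ : Lp ℂ ∞ μ →ₗ[ℂ] (H →L[ℂ] H)} {K : Submodule ℂ H}
    {m : X → ℕ∞} (h : IsMultiplicityFunction ρ K m) :
    ∃ ξ : ℕ → H, ∃ m' : X → ℕ∞, Measurable m' ∧ m =ᵐ[μ] m' ∧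
      IsOrthogonalSystem ρ K ξ (levelWeight m') := by
  obtain ⟨hK, J, hJ⟩ := h.exists_equiv
  have hm := h.1
  have hsys := isOrthogonalSystem_model (μ := μ) (p := fun i _ => i) (m := m)
    (measurable_levelWeight hm.measurable_mk) (levelWeight_nonneg _)
    (integrable_levelWeight hm.measurable_mk) (fun i => measurable_const)
    (fun x i j _ _ hij => hij) (by
      filter_upwards [hm.ae_eq_mk] with x hx k
      simp [levelWeight_ne_zero, hx])
  exact ⟨_, _, hm.measurable_mk, hm.ae_eq_mk, hsys.of_equiv hK J hJ⟩

theorem not_orthonormal_of_coord_eq_zero {n : ℕ} {f : Fin (n + 1) → EllTwo}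
    (hf : Orthonormal ℂ f) (h0 : ∀ i, ∀ k, n ≤ k → f i k = 0) : False := by
  have hli : LinearIndependent ℂ (fun (i : Fin (n + 1)) (k : Fin n) => f i k) := by
    rw [Fintype.linearIndependent_iff]
    intro c hc
    refine Fintype.linearIndependent_iff.1 hf.linearIndependent c ?_
    ext k
    rw [← inner_coordVec, inner_sum]
    simp only [inner_smul_right, inner_coordVec]
    by_cases hk : k < n
    · have := congrFun hc ⟨k, hk⟩
      simpa using this
    · simp [h0 _ k (not_lt.1 hk)]
  have := hli.fintype_card_le_finrank
  simp at this

/-- The level vectors of `m'`, carried into `L²(X, m, μ)`, are a.e. pointwise orthogonal with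
squared norms `1_{i < m'}`. Where `m x = n < m' x`, the first `n + 1` of them would be orthonormal
in `ℂⁿ`. -/
theorem IsMultiplicityFunction.ae_le {ρ : Lp ℂ ∞ μ →ₗ[ℂ] (H →L[ℂ] H)} {K : Submodule ℂ H}
    {m m' : X → ℕ∞} (h : IsMultiplicityFunction ρ K m) (h' : IsMultiplicityFunction ρ K m') :
    ∀ᵐ x ∂μ, m' x ≤ m x := by
  obtain ⟨ξ, m₁, -, hmm, hsys⟩ := h'.exists_system
  obtain ⟨hK, J, hJ⟩ := h.exists_equiv
  let f : ℕ → LTwoMult μ m := fun i => J ⟨ξ i, hsys.mem i⟩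
  have hin : ∀ i j g, inner ℂ (ξ i) (ρ g (ξ j)) =
      ∫ x, g x * inner ℂ ((f i : Lp EllTwo 2 μ) x) ((f j : Lp EllTwo 2 μ) x) ∂μ := by
    intro i j g
    rw [← inner_mulRep, ← hJ, ← Submodule.coe_inner, J.inner_map_map]
    rfl
  have hortho : ∀ i j, (fun x => (inner ℂ ((f i : Lp EllTwo 2 μ) x) ((f j : Lp EllTwo 2 μ) x) : ℂ))
      =ᵐ[μ] fun x => if i = j then (levelWeight m₁ i x : ℂ) else 0 := by
    intro i j
    refine ae_eq_of_forall_integral_mul_eq (integrable_inner_coeFn _ _) ?_ fun g => ?_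
    · split_ifs
      · exact (hsys.integrable i).ofReal
      · exact integrable_zero _ _ _
    · rw [← hin]
      split_ifs with hij
      · subst hij
        rw [hsys.inner_self]
      · rw [hsys.inner_ne _ _ hij]; simp
  have hmem := ae_all_iff.2 fun i => (f i).2
  filter_upwards [ae_all_iff.2 fun i => ae_all_iff.2 (hortho i), hmem, hmm] with x h1 h2 h3
  by_contra hlt
  rw [not_le] at hlt
  obtain ⟨n, hn⟩ := ENat.ne_top_iff_exists.1 hlt.ne_top
  refine not_orthonormal_of_coord_eq_zero (n := n)
    (f := fun i : Fin (n + 1) => (f i : Lp EllTwo 2 μ) x) ?_ fun i k hk => ?_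
  · rw [orthonormal_iff_ite]
    intro i j
    rw [h1]
    by_cases hij : i = j
    · subst hij
      have hlt' : ((i : ℕ) : ℕ∞) < m₁ x := by
        rw [← h3]
        refine lt_of_le_of_lt ?_ hlt
        rw [← hn]
        exact_mod_cast Nat.lt_succ_iff.1 i.2
      have : levelWeight m₁ i x = 1 := by simp [levelWeight, hlt']
      simp [this]
    · simp [hij, Fin.val_inj]
  · exact h2 i k (by rw [← hn]; exact_mod_cast hk)

/-- Multiplicity functions are unique up to null sets. -/
theorem IsMultiplicityFunction.ae_eq {ρ : Lp ℂ ∞ μ →ₗ[ℂ] (H →L[ℂ] H)} {K : Submodule ℂ H}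
    {m m' : X → ℕ∞} (h : IsMultiplicityFunction ρ K m) (h' : IsMultiplicityFunction ρ K m') :
    m =ᵐ[μ] m' := by
  filter_upwards [h.ae_le h', h'.ae_le h] with x h1 h2 using le_antisymm h2 h1

variable [CompleteSpace H]

open Classical in
-- At each `x`, the vector of index `i` is placed in the coordinate given by the rank of `i` among
-- the indices active at `x`. The model system so obtained has the same densities.
theorem IsOrthogonalSystem.isMultiplicityFunction_nat
    {ρ : Lp ℂ ∞ μ →ₗ[ℂ] (H →L[ℂ] H)} {K : Submodule ℂ H} {ξ : ℕ → H} {w : ℕ → X → ℝ}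
    (h : IsOrthogonalSystem ρ K ξ w) (hρ : IsRepresentation ρ) (hc : IsClosed (K : Set H))
    (hK : ∀ g, ∀ v ∈ K, ρ g v ∈ K) :
    IsMultiplicityFunction ρ K (fun x => {i | w i x ≠ 0}.encard) := by
  have hwm : ∀ i, MeasurableSet {x | w i x ≠ 0} := fun i =>
    (h.measurable i) (measurableSet_singleton 0).compl
  have hp : ∀ i, Measurable (fun x => Nat.count (fun j => w j x ≠ 0) i) := by
    intro i
    induction i with
    | zero => simp
    | succ n ih =>
      simp only [Nat.count_succ]
      exact ih.add (Measurable.ite (hwm n) measurable_const measurable_const)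
  have hm : ∀ x, ∀ k : ℕ, (k : ℕ∞) < {i | w i x ≠ 0}.encard ↔
      ∃ i, w i x ≠ 0 ∧ Nat.count (fun j => w j x ≠ 0) i = k :=
    fun x k => lt_encard_iff_exists_count _ k
  have hsys := isOrthogonalSystem_model h.measurable h.nonneg h.integrable hp
    (fun x i j hi hj hij => Nat.count_injective hi hj hij)
    (Filter.Eventually.of_forall hm)
  obtain ⟨J, hJ⟩ := h.exists_equiv hsys hρ isRepresentation_mulRep hc (isClosed_LTwoMult _) hK
    (fun g => mulRep_mem_LTwoMult g)
  refine ⟨Measurable.aemeasurable (measurable_of_lt_iff fun k => ?_), hK, J, fun g v => ?_⟩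
  · simp only [hm, Set.ofPred_exists]
    exact MeasurableSet.iUnion fun i => (hwm i).inter (hp i (measurableSet_singleton k))
  · rw [hJ]
    exact coeFn_mulRep g _

theorem IsOrthogonalSystem.isMultiplicityFunction {I : Type*} [Denumerable I]
    {ρ : Lp ℂ ∞ μ →ₗ[ℂ] (H →L[ℂ] H)} {K : Submodule ℂ H} {ξ : I → H} {w : I → X → ℝ}
    (h : IsOrthogonalSystem ρ K ξ w) (hρ : IsRepresentation ρ) (hc : IsClosed (K : Set H))
    (hK : ∀ g, ∀ v ∈ K, ρ g v ∈ K) :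
    IsMultiplicityFunction ρ K (fun x => {i | w i x ≠ 0}.encard) := by
  have := (h.comp_equiv (Denumerable.eqv I).symm).isMultiplicityFunction_nat hρ hc hK
  convert this using 2 with x
  rw [← (Denumerable.eqv I).symm.injective.encard_image]
  congr 1
  ext i
  simp [Set.mem_image_equiv]

end Multiplicity

/-! ### Existence of orthogonal systems; subspaces and orthogonal sums -/

section Existence

variable {X : Type*} [MeasurableSpace X] {μ : Measure X}
variable {H : Type*} [NormedAddCommGroup H] [InnerProductSpace ℂ H]

/-- The closed subspace generated by the first `n` of the vectors `η i`. -/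
def cyclicSpan (ρ : Lp ℂ ∞ μ →ₗ[ℂ] (H →L[ℂ] H)) (η : ℕ → H) (n : ℕ) : Submodule ℂ H :=
  (Submodule.span ℂ {v | ∃ i < n, ∃ g, v = ρ g (η i)}).topologicalClosure

theorem mem_cyclicSpan (ρ : Lp ℂ ∞ μ →ₗ[ℂ] (H →L[ℂ] H)) (η : ℕ → H) {n i : ℕ} (hi : i < n)
    (g : Lp ℂ ∞ μ) : ρ g (η i) ∈ cyclicSpan ρ η n :=
  Submodule.le_topologicalClosure _ (Submodule.subset_span ⟨i, hi, g, rfl⟩)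

theorem cyclicSpan_le {ρ : Lp ℂ ∞ μ →ₗ[ℂ] (H →L[ℂ] H)} {η : ℕ → H} {n : ℕ} {K : Submodule ℂ H}
    (hc : IsClosed (K : Set H)) (h : ∀ i < n, ∀ g, ρ g (η i) ∈ K) : cyclicSpan ρ η n ≤ K := by
  refine Submodule.topologicalClosure_minimal _ (Submodule.span_le.2 ?_) hc
  rintro _ ⟨i, hi, g, rfl⟩
  exact h i hi g

theorem cyclicSpan_mono (ρ : Lp ℂ ∞ μ →ₗ[ℂ] (H →L[ℂ] H)) (η : ℕ → H) {n k : ℕ} (h : n ≤ k) :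
    cyclicSpan ρ η n ≤ cyclicSpan ρ η k :=
  cyclicSpan_le (Submodule.isClosed_topologicalClosure _)
    fun _ hi g => mem_cyclicSpan ρ η (hi.trans_le h) g

theorem IsOrthogonalSystem.sum {I I' : Type*} {ρ : Lp ℂ ∞ μ →ₗ[ℂ] (H →L[ℂ] H)}
    {K K₁ K₂ : Submodule ℂ H} {ξ₁ : I → H} {ξ₂ : I' → H} {w₁ : I → X → ℝ} {w₂ : I' → X → ℝ}
    (h₁ : IsOrthogonalSystem ρ K₁ ξ₁ w₁) (h₂ : IsOrthogonalSystem ρ K₂ ξ₂ w₂)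
    (hK₁ : ∀ g, ∀ v ∈ K₁, ρ g v ∈ K₁) (hK₂ : ∀ g, ∀ v ∈ K₂, ρ g v ∈ K₂)
    (hle₁ : K₁ ≤ K) (hle₂ : K₂ ≤ K) (hort : K₂ ≤ K₁ᗮ)
    (hsum : ∀ v ∈ K, ∃ v₁ ∈ K₁, ∃ v₂ ∈ K₂, v = v₁ + v₂) :
    IsOrthogonalSystem ρ K (Sum.elim ξ₁ ξ₂) (Sum.elim w₁ w₂) where
  mem := by rintro (i | i); exacts [hle₁ (h₁.mem i), hle₂ (h₂.mem i)]
  measurable := by rintro (i | i); exacts [h₁.measurable i, h₂.measurable i]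
  nonneg := by rintro (i | i); exacts [h₁.nonneg i, h₂.nonneg i]
  integrable := by rintro (i | i); exacts [h₁.integrable i, h₂.integrable i]
  inner_self := by rintro (i | i); exacts [h₁.inner_self i, h₂.inner_self i]
  inner_ne := by
    rintro (i | i) (j | j) hij g
    · exact h₁.inner_ne i j (fun e => hij (by rw [e])) g
    · exact Submodule.inner_right_of_mem_orthogonal (h₁.mem i) (hort (hK₂ g _ (h₂.mem j)))
    · exact Submodule.inner_left_of_mem_orthogonal (hK₁ g _ (h₁.mem j)) (hort (h₂.mem i))
    · exact h₂.inner_ne i j (fun e => hij (by rw [e])) g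
  total := by
    intro v hv hz
    obtain ⟨v₁, hv₁, v₂, hv₂, rfl⟩ := hsum v hv
    have h1 : v₁ = 0 := h₁.total v₁ hv₁ fun i g => by
      have := hz (Sum.inl i) g
      rwa [Sum.elim_inl, inner_add_right, Submodule.inner_right_of_mem_orthogonal
        (hK₁ g _ (h₁.mem i)) (hort hv₂), add_zero] at this
    have h2 : v₂ = 0 := h₂.total v₂ hv₂ fun i g => by
      have := hz (Sum.inr i) g
      rwa [Sum.elim_inr, inner_add_right, Submodule.inner_left_of_mem_orthogonal
        hv₁ (hort (hK₂ g _ (h₂.mem i))), zero_add] at this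
    rw [h1, h2, add_zero]

/-- The density is the pointwise squared norm of the image of `ξ` in the model. Thus normality on
subspaces of `K` comes from the model and need not be assumed of `ρ`. -/
theorem IsMultiplicityFunction.exists_density {ρ : Lp ℂ ∞ μ →ₗ[ℂ] (H →L[ℂ] H)}
    {K : Submodule ℂ H} {m : X → ℕ∞} (h : IsMultiplicityFunction ρ K m) {ξ : H} (hξ : ξ ∈ K) :
    ∃ w : X → ℂ, Integrable w μ ∧ ∀ g : Lp ℂ ∞ μ, inner ℂ ξ (ρ g ξ) = ∫ x, g x * w x ∂μ := by
  obtain ⟨hK, J, hJ⟩ := h.exists_equiv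
  refine ⟨_, integrable_inner_coeFn (J ⟨ξ, hξ⟩ : Lp EllTwo 2 μ) (J ⟨ξ, hξ⟩), fun g => ?_⟩
  rw [← inner_mulRep, ← hJ, ← Submodule.coe_inner, J.inner_map_map]
  rfl

variable [CompleteSpace H] [IsFiniteMeasure μ]

/-- The integral of `w` over `s` is `‖ρ 1_s ξ‖² ≥ 0`, so `w` is a.e. real and nonnegative and can be
modified on a null set. -/
theorem exists_density {ρ : Lp ℂ ∞ μ →ₗ[ℂ] (H →L[ℂ] H)} (hρ : IsRepresentation ρ) {ξ : H}
    (h : ∃ w : X → ℂ, Integrable w μ ∧ ∀ g : Lp ℂ ∞ μ, inner ℂ ξ (ρ g ξ) = ∫ x, g x * w x ∂μ) :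
    ∃ w : X → ℝ, Measurable w ∧ (∀ x, 0 ≤ w x) ∧ Integrable w μ ∧
      ∀ g : Lp ℂ ∞ μ, inner ℂ ξ (ρ g ξ) = ∫ x, g x * (w x : ℂ) ∂μ := by
  obtain ⟨w, hw, hg⟩ := h
  have hset : ∀ s, MeasurableSet s → ∃ c : ℝ, 0 ≤ c ∧ ∫ x in s, w x ∂μ = (c : ℂ) := by
    intro s hs
    refine ⟨‖ρ (indLp μ hs) ξ‖ ^ 2, by positivity, ?_⟩
    have h1 := hρ.inner_apply_apply (indLp μ hs) (indLp μ hs) ξ ξ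
    rw [star_indLp_smul, hg, integral_indLp_mul, inner_self_eq_norm_sq_to_K] at h1
    rw [← h1]
    simp
  have hre : 0 ≤ᵐ[μ] fun x => (w x).re := by
    refine ae_nonneg_of_forall_setIntegral_nonneg hw.re fun s hs _ => ?_
    obtain ⟨c, hc, hcs⟩ := hset s hs
    have := integral_re (𝕜 := ℂ) (hw.integrableOn (s := s))
    simp only [RCLike.re_to_complex] at this
    rw [this, hcs]
    simpa using hc
  have him : (fun x => (w x).im) =ᵐ[μ] fun _ => 0 := by
    refine Integrable.ae_eq_of_forall_setIntegral_eq _ _ hw.im (integrable_zero _ _ _)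
      fun s hs _ => ?_
    obtain ⟨c, hc, hcs⟩ := hset s hs
    have := integral_im (𝕜 := ℂ) (hw.integrableOn (s := s))
    simp only [RCLike.im_to_complex] at this
    rw [this, hcs]
    simp
  have hm : AEStronglyMeasurable (fun x => (w x).re) μ := hw.re.aestronglyMeasurable
  have hae : ∀ᵐ x ∂μ, ((max 0 (hm.mk _ x) : ℝ) : ℂ) = w x := by
    filter_upwards [hre, him, hm.ae_eq_mk] with x h1 h2 h3
    have h1' : 0 ≤ (w x).re := h1
    rw [← h3, max_eq_right h1']
    apply Complex.ext <;> simp [h2]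
  refine ⟨fun x => max 0 (hm.mk _ x), ?_, fun x => le_max_left _ _, ?_, fun g => ?_⟩
  · exact measurable_const.max hm.stronglyMeasurable_mk.measurable
  · refine hw.re.congr ?_
    filter_upwards [hae] with x hx
    rw [← hx]; simp
  · rw [hg]
    refine integral_congr_ae ?_
    filter_upwards [hae] with x hx
    rw [hx]

theorem cyclicSpan_invariant {ρ : Lp ℂ ∞ μ →ₗ[ℂ] (H →L[ℂ] H)} (hρ : IsRepresentation ρ)
    (η : ℕ → H) (n : ℕ) (g : Lp ℂ ∞ μ) {v : H} (hv : v ∈ cyclicSpan ρ η n) :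
    ρ g v ∈ cyclicSpan ρ η n := by
  refine cyclicSpan_le (K := (cyclicSpan ρ η n).comap (ρ g).toLinearMap) ?_ ?_ hv
  · exact (Submodule.isClosed_topologicalClosure _).preimage (ρ g).continuous
  · intro i hi f
    change ρ g (ρ f (η i)) ∈ cyclicSpan ρ η n
    rw [hρ.mul_apply]
    exact mem_cyclicSpan ρ η hi _

instance (ρ : Lp ℂ ∞ μ →ₗ[ℂ] (H →L[ℂ] H)) (η : ℕ → H) (n : ℕ) :
    CompleteSpace (cyclicSpan ρ η n) :=
  (Submodule.isClosed_topologicalClosure _).completeSpace_coe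

/-- Gram–Schmidt: a normal, countably generated representation has an orthogonal system. -/
theorem exists_isOrthogonalSystem {ρ : Lp ℂ ∞ μ →ₗ[ℂ] (H →L[ℂ] H)} (hρ : IsRepresentation ρ)
    {K : Submodule ℂ H} (hc : IsClosed (K : Set H)) (hK : ∀ g, ∀ v ∈ K, ρ g v ∈ K)
    (hnorm : ∀ ξ ∈ K, ∃ w : X → ℂ, Integrable w μ ∧
      ∀ g : Lp ℂ ∞ μ, inner ℂ ξ (ρ g ξ) = ∫ x, g x * w x ∂μ)
    (η : ℕ → H) (hη : ∀ i, η i ∈ K)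
    (htot : ∀ v ∈ K, (∀ i g, inner ℂ (ρ g (η i)) v = 0) → v = 0) :
    ∃ (ξ : ℕ → H) (w : ℕ → X → ℝ), IsOrthogonalSystem ρ K ξ w := by
  let M := cyclicSpan ρ η
  let P : ℕ → H := fun n => ((M n).orthogonalProjectionOnto (η n) : H)
  have hP : ∀ n, P n ∈ M n := fun n => Subtype.mem _
  let ξ : ℕ → H := fun n => η n - P n
  have hMK : ∀ n, M n ≤ K := fun n => cyclicSpan_le hc fun i _ g => hK g _ (hη i)
  have hξK : ∀ n, ξ n ∈ K := fun n => K.sub_mem (hη n) (hMK n (hP n))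
  have hξo : ∀ n, ξ n ∈ (M n)ᗮ := fun n => Submodule.sub_starProjection_mem_orthogonal _
  have hξM : ∀ n k, n < k → ξ n ∈ M k := fun n k hnk => by
    refine (M k).sub_mem ?_ (cyclicSpan_mono ρ η hnk.le (hP n))
    have := mem_cyclicSpan ρ η hnk (Lp.const ∞ μ (1 : ℂ))
    rwa [hρ.one_apply] at this
  choose w hw1 hw2 hw3 hw4 using fun n => exists_density hρ (hnorm (ξ n) (hξK n))
  refine ⟨ξ, w, hξK, hw1, hw2, hw3, hw4, fun i j hij g => ?_, fun v hv h => ?_⟩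
  · rcases lt_or_gt_of_ne hij with h | h
    · rw [← star_star g, ← hρ.inner_left]
      exact Submodule.inner_right_of_mem_orthogonal
        (cyclicSpan_invariant hρ η j _ (hξM i j h)) (hξo j)
    · exact Submodule.inner_left_of_mem_orthogonal
        (cyclicSpan_invariant hρ η i _ (hξM j i h)) (hξo i)
  -- By induction `v` is orthogonal to the span `M i` of the earlier generators, hence to `ρ g (P
  -- i)`; orthogonality to `ρ g (ξ i)` then gives it for `ρ g (η i)`.
  · refine htot v hv fun i => ?_
    induction i using Nat.strong_induction_on with
    | _ i ih =>
      intro g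
      have hle : M i ≤ (Submodule.span ℂ {v})ᗮ := by
        refine cyclicSpan_le (Submodule.isClosed_orthogonal _) fun j hj f => ?_
        rw [Submodule.mem_orthogonal_singleton_iff_inner_left]
        exact ih j hj f
      have h1 : inner ℂ (ρ g (P i)) v = 0 :=
        Submodule.mem_orthogonal_singleton_iff_inner_left.1
          (hle (cyclicSpan_invariant hρ η i g (hP i)))
      have h2 : η i = ξ i + P i := by simp [ξ]
      rw [h2, map_add, inner_add_left, h, h1, add_zero]

/-- The projections to `L` of a system for `K` generate `L`: for `v ∈ L`, also `ρ (star g) v ∈ L`,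
so it cannot distinguish `ξ i` from its projection. Gram–Schmidt then applies. -/
theorem IsMultiplicityFunction.exists_of_le {ρ : Lp ℂ ∞ μ →ₗ[ℂ] (H →L[ℂ] H)}
    (hρ : IsRepresentation ρ) {K L : Submodule ℂ H} {m : X → ℕ∞}
    (h : IsMultiplicityFunction ρ K m) (hLK : L ≤ K) (hL : IsClosed (L : Set H))
    (hinv : ∀ g, ∀ v ∈ L, ρ g v ∈ L) : ∃ m', IsMultiplicityFunction ρ L m' := by
  have : CompleteSpace L := hL.completeSpace_coe
  obtain ⟨ξ, _, -, -, hsys⟩ := h.exists_system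
  obtain ⟨ζ, w, hζ⟩ := exists_isOrthogonalSystem hρ hL hinv
    (fun v hv => h.exists_density (hLK hv))
    (fun i => (L.orthogonalProjectionOnto (ξ i) : H)) (fun i => Subtype.mem _) (by
      intro v hv hz
      refine hsys.total v (hLK hv) fun i g => ?_
      have h1 := hz i g
      rw [hρ.inner_left] at h1 ⊢
      have h2 : inner ℂ (ξ i - L.orthogonalProjectionOnto (ξ i)) (ρ (star g) v) = 0 :=
        Submodule.inner_left_of_mem_orthogonal (hinv _ v hv)
          (Submodule.sub_starProjection_mem_orthogonal _)
      rwa [inner_sub_left, h1, sub_zero] at h2)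
  exact ⟨_, hζ.isMultiplicityFunction hρ hL hinv⟩

/-- The union of level systems for `K₁` and `K₂` is a system for `K`; its active indices are counted
and compared with `m` by uniqueness. -/
theorem IsMultiplicityFunction.add {ρ : Lp ℂ ∞ μ →ₗ[ℂ] (H →L[ℂ] H)} (hρ : IsRepresentation ρ)
    {K K₁ K₂ : Submodule ℂ H} {m₁ m₂ m : X → ℕ∞} (h₁ : IsMultiplicityFunction ρ K₁ m₁)
    (h₂ : IsMultiplicityFunction ρ K₂ m₂) (h : IsMultiplicityFunction ρ K m)
    (hc : IsClosed (K : Set H)) (hle₁ : K₁ ≤ K) (hle₂ : K₂ ≤ K) (hort : K₂ ≤ K₁ᗮ)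
    (hsum : ∀ v ∈ K, ∃ v₁ ∈ K₁, ∃ v₂ ∈ K₂, v = v₁ + v₂) :
    ∀ᵐ x ∂μ, m₁ x + m₂ x = m x := by
  obtain ⟨ξ₁, m₁', -, he₁, hs₁⟩ := h₁.exists_system
  obtain ⟨ξ₂, m₂', -, he₂, hs₂⟩ := h₂.exists_system
  obtain ⟨-, hK₁, -⟩ := h₁
  obtain ⟨-, hK₂, -⟩ := h₂
  have hK := h.2.choose
  have hmul := (hs₁.sum hs₂ hK₁ hK₂ hle₁ hle₂ hort hsum).isMultiplicityFunction hρ hc hK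
  filter_upwards [hmul.ae_eq h, he₁, he₂] with x hx h1 h2
  rw [← hx, h1, h2, ← encard_levelWeight m₁' x, ← encard_levelWeight m₂' x,
    ← (Sum.inl_injective (β := ℕ)).encard_image,
    ← (Sum.inr_injective (α := ℕ)).encard_image {i | levelWeight m₂' i x ≠ 0}, ← Set.encard_union_eq]
  · congr 1
    ext (i | i) <;> simp
  · exact Set.disjoint_image_inl_image_inr

end Existence

/-! ### Strong invariance, fibres and injectivity domains of `r` -/

section Fibres

variable {X : Type*} {r : X → X}

/-- The proportion of the points of the fibre of `r` over `x` which lie in `A`. -/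
def fibreWeight (r : X → X) (A : Set X) (x : X) : ℝ :=
  ((r ⁻¹' {x}).ncard : ℝ)⁻¹ * ((r ⁻¹' {x} ∩ A).ncard : ℝ)

theorem fibreWeight_nonneg (r : X → X) (A : Set X) (x : X) : 0 ≤ fibreWeight r A x := by
  unfold fibreWeight; positivity

theorem fibreWeight_ne_zero (hfin : ∀ x, (r ⁻¹' {x}).Finite) {A : Set X} {x : X} :
    fibreWeight r A x ≠ 0 ↔ x ∈ r '' A := by
  have h1 : (r ⁻¹' {x} ∩ A).ncard ≠ 0 ↔ x ∈ r '' A := by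
    rw [← Nat.pos_iff_ne_zero, Set.ncard_pos ((hfin x).inter_of_left A)]
    constructor
    · rintro ⟨y, hy, hA⟩; exact ⟨y, hA, hy⟩
    · rintro ⟨y, hA, hy⟩; exact ⟨y, hy, hA⟩
  rw [← h1, fibreWeight]
  constructor
  · intro h h0
    simp [h0] at h
  · intro h
    have h2 : (r ⁻¹' {x}).ncard ≠ 0 := by
      have := Set.ncard_le_ncard (Set.inter_subset_left (s := r ⁻¹' {x}) (t := A)) (hfin x)
      omega
    have h3 : ((r ⁻¹' {x}).ncard : ℝ) ≠ 0 := by exact_mod_cast h2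
    have h4 : ((r ⁻¹' {x} ∩ A).ncard : ℝ) ≠ 0 := by exact_mod_cast h
    positivity

theorem fibreAverage_comp_mul_indicator (hfin : ∀ x, (r ⁻¹' {x}).Finite) (g : X → ℂ) (A : Set X)
    (x : X) : fibreAverage r (fun y => g (r y) * A.indicator 1 y) x =
      g x * (fibreWeight r A x : ℂ) := by
  classical
  have h1 : ∑ᶠ y ∈ r ⁻¹' {x}, g (r y) * A.indicator 1 y =
      g x * ((r ⁻¹' {x} ∩ A).ncard : ℂ) := by
    have h2 : ∀ y ∈ (hfin x).toFinset, g (r y) * A.indicator 1 y =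
        g x * (if y ∈ A then 1 else 0) := by
      intro y hy
      have hy' : r y = x := by simpa using hy
      rw [hy', Set.indicator_apply]
      rfl
    rw [finsum_mem_eq_finite_toFinset_sum _ (hfin x), Finset.sum_congr rfl h2,
      ← Finset.mul_sum, Finset.sum_boole]
    congr 2
    rw [← Set.ncard_coe_finset]
    congr 1
    ext y
    simp
  rw [fibreAverage, h1, fibreWeight]
  push_cast
  ring

/-- Each `y` over `x` lies in exactly one `D (κ y)`, and `κ` is injective on the fibre because `r`
is injective on each `D k`. The pairs therefore form the disjoint union over `y` of `{j | j < m y} ×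
{κ y}`. -/
theorem encard_fibre_eq_fibreSum (hfin : ∀ x, (r ⁻¹' {x}).Finite) {D : ℕ → Set X}
    (hD : Pairwise (Function.onFun Disjoint D)) (hinj : ∀ k, Set.InjOn r (D k)) (m : X → ℕ∞) {x : X}
    (hx : ∀ y, r y = x → ∃ k, y ∈ D k) :
    {p : ℕ × ℕ | x ∈ r '' (D p.2 ∩ {y | (p.1 : ℕ∞) < m y})}.encard = fibreSum r m x := by
  classical
  choose! κ hκ using hx
  have hset : {p : ℕ × ℕ | x ∈ r '' (D p.2 ∩ {y | (p.1 : ℕ∞) < m y})} =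
      ⋃ y ∈ (hfin x).toFinset, (fun j : ℕ => (j, κ y)) '' {j | (j : ℕ∞) < m y} := by
    ext ⟨j, k⟩
    simp only [Set.mem_ofPred_eq, Set.mem_image, Set.mem_inter_iff, Set.mem_iUnion,
      Set.Finite.mem_toFinset, Set.mem_preimage, Set.mem_singleton_iff, Prod.mk.injEq]
    constructor
    · rintro ⟨y, ⟨hk, hj⟩, hy⟩
      refine ⟨y, hy, j, hj, rfl, ?_⟩
      by_contra hne
      exact Set.disjoint_left.1 (hD hne) (hκ y hy) hk
    · rintro ⟨y, hy, j', hj, rfl, rfl⟩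
      exact ⟨y, ⟨hκ y hy, hj⟩, hy⟩
  have hS : ∀ y, ((fun j : ℕ => (j, κ y)) '' {j | (j : ℕ∞) < m y}).encard = m y := by
    intro y
    rw [Function.Injective.encard_image (fun a b h => (Prod.mk.inj h).1), encard_natCast_lt]
  have hsum : ∀ F : Finset X, (∀ y ∈ F, r y = x) →
      (⋃ y ∈ F, (fun j : ℕ => (j, κ y)) '' {j | (j : ℕ∞) < m y}).encard = ∑ y ∈ F, m y := by
    intro F
    induction F using Finset.induction_on with
    | empty => simp
    | insert a F ha ih =>
      intro hF
      rw [Finset.set_biUnion_insert, Set.encard_union_eq, hS, Finset.sum_insert ha,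
        ih fun y hy => hF y (Finset.mem_insert_of_mem hy)]
      rw [Set.disjoint_left]
      rintro _ ⟨j, -, rfl⟩ h
      simp only [Set.mem_iUnion, Set.mem_image, Prod.mk.injEq] at h
      obtain ⟨y, hy, j', -, -, hκy⟩ := h
      have ha' := hF a (Finset.mem_insert_self _ _)
      have hy' := hF y (Finset.mem_insert_of_mem hy)
      have : y = a := hinj (κ a) (hκy ▸ hκ y hy') (hκ a ha') (hy'.trans ha'.symm)
      exact ha (this ▸ hy)
  rw [hset, hsum _ (by simp), fibreSum, finsum_mem_eq_finite_toFinset_sum _ (hfin x)]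

theorem fibreAverage_indicator (hfin : ∀ x, (r ⁻¹' {x}).Finite) (A : Set X) :
    fibreAverage r (A.indicator 1) = fun x => (fibreWeight r A x : ℂ) := by
  funext x
  have := fibreAverage_comp_mul_indicator hfin (fun _ => 1) A x
  simpa using this

theorem indicator_one_bounded (A : Set X) :
    ∃ C : ℝ, ∀ x, ‖A.indicator (1 : X → ℂ) x‖ ≤ C :=
  ⟨1, fun x => (norm_indicator_le_norm_self _ x).trans (by simp)⟩

theorem fibreWeight_le_one (hfin : ∀ x, (r ⁻¹' {x}).Finite) (A : Set X) (x : X) :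
    fibreWeight r A x ≤ 1 := by
  have h1 : ((r ⁻¹' {x} ∩ A).ncard : ℝ) ≤ ((r ⁻¹' {x}).ncard : ℝ) := by
    exact_mod_cast Set.ncard_le_ncard Set.inter_subset_left (hfin x)
  exact inv_mul_le_one_of_le₀ h1 (by positivity)

variable [MeasurableSpace X] {μ : Measure X}

theorem IsStronglyInvariant.aemeasurable_fibreWeight (h : IsStronglyInvariant r μ)
    (hfin : ∀ x, (r ⁻¹' {x}).Finite) {A : Set X} (hA : MeasurableSet A) :
    AEMeasurable (fibreWeight r A) μ := by
  have := h.aestronglyMeasurable _ (measurable_one.indicator hA) (indicator_one_bounded A)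
  rw [fibreAverage_indicator hfin] at this
  simpa using this.re.aemeasurable

/-- The image is where the fibre average of the indicator of `A` is nonzero, and strong invariance
makes that average a.e. measurable. -/
theorem IsStronglyInvariant.nullMeasurableSet_image (h : IsStronglyInvariant r μ)
    (hfin : ∀ x, (r ⁻¹' {x}).Finite) {A : Set X} (hA : MeasurableSet A) :
    NullMeasurableSet (r '' A) μ := by
  have : r '' A = fibreWeight r A ⁻¹' {0}ᶜ := by
    ext x
    rw [← fibreWeight_ne_zero hfin]
    rfl
  rw [this]
  exact (h.aemeasurable_fibreWeight hfin hA).nullMeasurable (measurableSet_singleton 0).compl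

/-- Strong invariance speaks of everywhere bounded measurable functions, so classes in `L^∞` are
first truncated at their norm. -/
theorem exists_bounded_representative (g : Lp ℂ ∞ μ) :
    ∃ g' : X → ℂ, Measurable g' ∧ (∃ C : ℝ, ∀ x, ‖g' x‖ ≤ C) ∧ g =ᵐ[μ] g' := by
  have hm := Lp.stronglyMeasurable g
  have hs : MeasurableSet {x | ‖g x‖ ≤ ‖g‖} := measurableSet_le hm.measurable.norm measurable_const
  refine ⟨{x | ‖g x‖ ≤ ‖g‖}.indicator g, hm.measurable.indicator hs, ⟨‖g‖, fun x => ?_⟩, ?_⟩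
  · by_cases hx : ‖g x‖ ≤ ‖g‖
    · rwa [Set.indicator_of_mem (by exact hx)]
    · rw [Set.indicator_of_notMem (by exact hx)]; simp
  · have hb : ∀ᵐ x ∂μ, ‖g x‖ ≤ ‖g‖ := by
      have hne : eLpNormEssSup g μ ≠ ∞ := by
        have := Lp.eLpNorm_ne_top g
        rwa [eLpNorm_exponent_top] at this
      filter_upwards [ae_le_eLpNormEssSup (f := g) (μ := μ)] with x hx
      rw [Lp.norm_def, eLpNorm_exponent_top, ← toReal_enorm]
      exact ENNReal.toReal_mono hne hx
    filter_upwards [hb] with x hx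
    rw [Set.indicator_of_mem (by exact hx)]

/-- Up to a null set, `X` is a countable disjoint union of sets on which `r` is injective. -/
theorem IsStronglyInvariant.exists_partition (h : IsStronglyInvariant r μ)
    (hr : MeasurePreserving r μ μ) (hfin : ∀ x, (r ⁻¹' {x}).Finite)
    (hsep : FibresCountablySeparated r) :
    ∃ D : ℕ → Set X, (∀ k, MeasurableSet (D k)) ∧ Pairwise (Function.onFun Disjoint D) ∧
      (∀ k, Set.InjOn r (D k)) ∧ ∀ᵐ x ∂μ, ∃ k, x ∈ D k := by
  classical
  obtain ⟨B, hB, hBs⟩ := hsep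
  let atom : Finset ℕ × Finset ℕ → Set X := fun c => (⋂ n ∈ c.1, B n) ∩ ⋂ n ∈ c.2, (B n)ᶜ
  have hatom : ∀ c, MeasurableSet (atom c) := fun c =>
    (Finset.measurableSet_biInter _ fun n _ => hB n).inter
      (Finset.measurableSet_biInter _ fun n _ => (hB n).compl)
  -- `Z c` consists of the points over which no `B n` splits the part of the fibre in `atom c`; by
  -- separation that part has at most one point.
  let Z : Finset ℕ × Finset ℕ → Set X := fun c =>
    ⋂ n, ((r '' (atom c ∩ B n))ᶜ ∪ (r '' (atom c \ B n))ᶜ)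
  have hZ : ∀ c, NullMeasurableSet (Z c) μ := fun c => NullMeasurableSet.iInter fun n =>
    (h.nullMeasurableSet_image hfin ((hatom c).inter (hB n))).compl.union
      (h.nullMeasurableSet_image hfin ((hatom c).diff (hB n))).compl
  let A : Finset ℕ × Finset ℕ → Set X := fun c => atom c ∩ r ⁻¹' Z c
  have hA : ∀ c, NullMeasurableSet (A c) μ := fun c =>
    (hatom c).nullMeasurableSet.inter ((hZ c).preimage hr.quasiMeasurePreserving)
  have hAinj : ∀ c, Set.InjOn r (A c) := by
    intro c y hy y' hy' hyy
    by_contra hne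
    obtain ⟨n, hn⟩ := hBs y y' hyy hne
    have hz := Set.mem_iInter.1 hy.2 n
    by_cases hyn : y ∈ B n
    · have hyn' : y' ∉ B n := fun hc => hn ⟨fun _ => hc, fun _ => hyn⟩
      rcases hz with hz | hz
      · exact hz ⟨y, ⟨hy.1, hyn⟩, rfl⟩
      · exact hz ⟨y', ⟨hy'.1, hyn'⟩, hyy.symm⟩
    · have hyn' : y' ∈ B n := by
        by_contra hc
        exact hn ⟨fun h => absurd h hyn, fun h => absurd h hc⟩
      rcases hz with hz | hz
      · exact hz ⟨y', ⟨hy'.1, hyn'⟩, hyy.symm⟩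
      · exact hz ⟨y, ⟨hy.1, hyn⟩, rfl⟩
  have hAcov : ∀ y, ∃ c, y ∈ A c := by
    intro y
    have hex : ∀ y', ∃ n, r y = r y' → y ≠ y' → ¬ (y ∈ B n ↔ y' ∈ B n) := by
      intro y'
      by_cases hc : r y = r y' ∧ y ≠ y'
      · obtain ⟨n, hn⟩ := hBs y y' hc.1 hc.2
        exact ⟨n, fun _ _ => hn⟩
      · exact ⟨0, fun h1 h2 => absurd ⟨h1, h2⟩ hc⟩
    choose ν hν using hex
    -- The fibre is finite, so finitely many of the `B n` already isolate `y` in it.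
    let N := (hfin (r y)).toFinset.image ν
    let c : Finset ℕ × Finset ℕ := (N.filter fun n => y ∈ B n, N.filter fun n => y ∉ B n)
    have hlone : ∀ y' ∈ atom c, r y' = r y → y' = y := by
      intro y' hy' hyy
      by_contra hne
      have hN : ν y' ∈ N := Finset.mem_image_of_mem ν (by simpa using hyy)
      refine hν y' hyy.symm (Ne.symm hne) ⟨fun hyB => ?_, fun hyB => ?_⟩
      · exact Set.mem_iInter₂.1 hy'.1 _ (Finset.mem_filter.2 ⟨hN, hyB⟩)
      · by_contra hyB'
        exact Set.mem_iInter₂.1 hy'.2 _ (Finset.mem_filter.2 ⟨hN, hyB'⟩) hyB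
    refine ⟨c, ⟨Set.mem_iInter₂.2 fun n hn => (Finset.mem_filter.1 hn).2,
      Set.mem_iInter₂.2 fun n hn => (Finset.mem_filter.1 hn).2⟩, Set.mem_iInter.2 fun n => ?_⟩
    by_cases hyn : y ∈ B n
    · right
      rintro ⟨y', ⟨hy', hyn'⟩, hyy⟩
      exact hyn' (hlone y' hy' hyy ▸ hyn)
    · left
      rintro ⟨y', ⟨hy', hyn'⟩, hyy⟩
      exact hyn (hlone y' hy' hyy ▸ hyn')
  -- The sets `A c` are only null measurable; measurable subsets of full measure in them keep the
  -- injectivity of `r`.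
  choose M hMA hM hMae using fun c => (hA c).exists_measurable_subset_ae_eq
  obtain ⟨e, he⟩ := exists_surjective_nat (Finset ℕ × Finset ℕ)
  refine ⟨disjointed fun k => M (e k), fun k => MeasurableSet.disjointed (fun k => hM _) k,
    disjoint_disjointed _, fun k => (hAinj (e k)).mono ((disjointed_subset _ _).trans (hMA _)), ?_⟩
  have hall : ∀ᵐ x ∂μ, ∀ c, (x ∈ M c ↔ x ∈ A c) :=
    ae_all_iff.2 fun c => (hMae c).mem_iff
  filter_upwards [hall] with x hx
  obtain ⟨c, hc⟩ := hAcov x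
  obtain ⟨k, rfl⟩ := he c
  have : x ∈ ⋃ k, disjointed (fun k => M (e k)) k := by
    rw [iUnion_disjointed]
    exact Set.mem_iUnion.2 ⟨k, (hx _).2 hc⟩
  exact Set.mem_iUnion.1 this

/-- `g ∘ r` is constant on fibres and comes out of the fibre average. This identifies `fibreWeight r
A` as the density of `1_A` under the action through `g ∘ r`. -/
theorem IsStronglyInvariant.integral_comp_mul_indicator (h : IsStronglyInvariant r μ)
    (hr : MeasurePreserving r μ μ) (hfin : ∀ x, (r ⁻¹' {x}).Finite) (g : Lp ℂ ∞ μ) {A : Set X}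
    (hA : MeasurableSet A) :
    ∫ x, g (r x) * A.indicator 1 x ∂μ = ∫ x, g x * (fibreWeight r A x : ℂ) ∂μ := by
  obtain ⟨g', hg', ⟨C, hC⟩, hgg⟩ := exists_bounded_representative g
  have h1 := h.integral_eq (fun y => g' (r y) * A.indicator 1 y)
    ((hg'.comp hr.measurable).mul (measurable_one.indicator hA)) ⟨C * 1, fun x => by
      rw [norm_mul]
      exact mul_le_mul (hC _) ((norm_indicator_le_norm_self _ x).trans (by simp))
        (norm_nonneg _) ((norm_nonneg _).trans (hC x))⟩
  have h2 : ∫ x, g (r x) * A.indicator 1 x ∂μ = ∫ x, g' (r x) * A.indicator 1 x ∂μ := by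
    refine integral_congr_ae ?_
    filter_upwards [hr.quasiMeasurePreserving.ae_eq_comp hgg] with x hx
    have hx' : g (r x) = g' (r x) := hx
    rw [hx']
  rw [h2, h1]
  refine integral_congr_ae ?_
  filter_upwards [hgg] with x hx
  rw [fibreAverage_comp_mul_indicator hfin, hx]

variable [IsFiniteMeasure μ]

theorem IsStronglyInvariant.integrable_fibreWeight (h : IsStronglyInvariant r μ)
    (hfin : ∀ x, (r ⁻¹' {x}).Finite) {A : Set X} (hA : MeasurableSet A) :
    Integrable (fibreWeight r A) μ := by
  refine Integrable.of_bound (h.aemeasurable_fibreWeight hfin hA).aestronglyMeasurable 1 ?_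
  refine Filter.Eventually.of_forall fun x => ?_
  rw [Real.norm_of_nonneg (fibreWeight_nonneg r A x)]
  exact fibreWeight_le_one hfin A x

/-- The fibre average of the indicator of a null set `N` is nonnegative with integral zero, hence
a.e. zero, yet it is nonzero over every fibre meeting `N`. -/
theorem IsStronglyInvariant.ae_forall_fibre (h : IsStronglyInvariant r μ)
    (hfin : ∀ x, (r ⁻¹' {x}).Finite) {P : X → Prop} (hP : ∀ᵐ y ∂μ, P y) :
    ∀ᵐ x ∂μ, ∀ y, r y = x → P y := by
  set N := toMeasurable μ {y | ¬ P y}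
  have hN : MeasurableSet N := measurableSet_toMeasurable _ _
  have hN0 : μ N = 0 := by rw [measure_toMeasurable]; exact hP
  have h1 := h.integral_eq _ (measurable_one.indicator hN) (indicator_one_bounded N)
  rw [fibreAverage_indicator hfin, integral_complex_ofReal, integral_indicator hN,
    Measure.restrict_eq_zero.2 hN0, integral_zero_measure] at h1
  have h2 : ∫ x, fibreWeight r N x ∂μ = 0 := by exact_mod_cast h1.symm
  rw [integral_eq_zero_iff_of_nonneg (fibreWeight_nonneg r N)
    (h.integrable_fibreWeight hfin hN)] at h2
  filter_upwards [h2] with x hx y hy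
  by_contra hPy
  exact (fibreWeight_ne_zero hfin).2 ⟨y, subset_toMeasurable _ _ hPy, hy⟩ hx

/-- Since `r` is injective on `A`, `s ∩ A` is `A ∩ r ⁻¹' (r '' (s ∩ A))`. Thus functions of `r x`
test `u` on every measurable subset of `A`; the image is replaced by a measurable set equal to it
a.e. -/
theorem IsStronglyInvariant.ae_eq_zero_of_integral_comp_mul (h : IsStronglyInvariant r μ)
    (hr : MeasurePreserving r μ μ) (hfin : ∀ x, (r ⁻¹' {x}).Finite) {A : Set X}
    (hA : MeasurableSet A) (hinj : Set.InjOn r A) {u : X → ℂ} (hu : Integrable u μ)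
    (hoff : ∀ᵐ x ∂μ, x ∉ A → u x = 0)
    (hz : ∀ (B : Set X) (hB : MeasurableSet B), ∫ x, indLp μ hB (r x) * u x ∂μ = 0) :
    u =ᵐ[μ] fun _ => 0 := by
  refine Integrable.ae_eq_of_forall_setIntegral_eq _ _ hu (integrable_zero _ _ _) fun s hs _ => ?_
  have hC := h.nullMeasurableSet_image hfin (hs.inter hA)
  obtain ⟨C, -, hCm, hCae⟩ := hC.exists_measurable_superset_ae_eq
  rw [integral_zero, ← hz C hCm, ← integral_indicator hs]
  refine integral_congr_ae ?_
  filter_upwards [hoff, hr.quasiMeasurePreserving.ae_eq_comp (coeFn_indLp (μ := μ) hCm),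
    hr.quasiMeasurePreserving.ae hCae.mem_iff] with x h1 h2 h3
  have h2' : indLp μ hCm (r x) = C.indicator (fun _ => 1) (r x) := h2
  rw [h2']
  by_cases hxA : x ∈ A
  · have h4 : r x ∈ r '' (s ∩ A) ↔ x ∈ s := by
      constructor
      · rintro ⟨y, ⟨hys, hyA⟩, hyx⟩
        exact hinj hyA hxA hyx ▸ hys
      · exact fun hxs => ⟨x, ⟨hxs, hxA⟩, rfl⟩
    have h5 : r x ∈ C ↔ x ∈ s := h3.trans h4
    by_cases hxs : x ∈ s <;> simp [h5, hxs]
  · rw [h1 hxA]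
    simp [h1 hxA]

end Fibres

/-! ### The multiplicity function of `U⁻¹ K` -/

section Covariance

variable {X : Type*} [MeasurableSpace X] {μ : Measure X} [IsFiniteMeasure μ] {r : X → X}
variable {H : Type*} [NormedAddCommGroup H] [InnerProductSpace ℂ H]

theorem coeFn_star_comp (hr : MeasurePreserving r μ μ) {s : Set X} (hs : MeasurableSet s) :
    ((star (Lp.compMeasurePreserving r hr (indLp μ hs)) : Lp ℂ ∞ μ) : X → ℂ) =ᵐ[μ]
      fun x => indLp μ hs (r x) := by
  filter_upwards [Lp.coeFn_star (Lp.compMeasurePreserving r hr (indLp μ hs)),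
    Lp.coeFn_compMeasurePreserving (indLp μ hs) hr,
    hr.quasiMeasurePreserving.ae_eq_comp (coeFn_indLp (μ := μ) hs)] with x h1 h2 h3
  have h3' : indLp μ hs (r x) = s.indicator (fun _ => 1) (r x) := h3
  rw [h1, Pi.star_apply, h2, Function.comp_apply, h3']
  by_cases hx : r x ∈ s <;> simp [hx]

/-- The vectors `U⁻¹ (1_{D k ∩ {j < m}} e_j)`, in the model of `ρ` on `K`, are an orthogonal system
for `U⁻¹ K`. -/
theorem IsStronglyInvariant.exists_fibreSystem (h : IsStronglyInvariant r μ)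
    (hr : MeasurePreserving r μ μ) (hfin : ∀ x, (r ⁻¹' {x}).Finite)
    {D : ℕ → Set X} (hD : ∀ k, MeasurableSet (D k)) (hdisj : Pairwise (Function.onFun Disjoint D))
    (hinj : ∀ k, Set.InjOn r (D k)) (hcov : ∀ᵐ x ∂μ, ∃ k, x ∈ D k)
    {ρ : Lp ℂ ∞ μ →ₗ[ℂ] (H →L[ℂ] H)} (U : H ≃ₗᵢ[ℂ] H)
    (hU : IsCovariant hr U.toLinearIsometry ρ) {K : Submodule ℂ H} {m m' : X → ℕ∞}
    (hm : IsMultiplicityFunction ρ K m) (hm' : Measurable m') (hmm : m =ᵐ[μ] m') :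
    ∃ (ξ : ℕ × ℕ → H) (w : ℕ × ℕ → X → ℝ),
      IsOrthogonalSystem ρ (K.map (U.symm.toLinearEquiv : H →ₗ[ℂ] H)) ξ w ∧
      ∀ p, w p =ᵐ[μ] fibreWeight r (D p.2 ∩ {y | (p.1 : ℕ∞) < m' y}) := by
  obtain ⟨hK, J, hJ⟩ := hm.exists_equiv
  let A : ℕ × ℕ → Set X := fun p => D p.2 ∩ {y | (p.1 : ℕ∞) < m' y}
  have hA : ∀ p, MeasurableSet (A p) := fun p =>
    (hD p.2).inter (hm' (MeasurableSet.of_discrete (s := Set.Ioi (p.1 : ℕ∞))))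
  have hAinj : ∀ p, Set.InjOn r (A p) := fun p => (hinj p.2).mono Set.inter_subset_left
  have hL : ∀ p, MemLp (fun x => ((√((A p).indicator (1 : X → ℝ) x) : ℝ) : ℂ) • coordVec p.1) 2 μ :=
    fun p => memLp_weight (measurable_one.indicator (hA p))
      (fun x => Set.indicator_nonneg (by simp) x)
      ((integrable_const (1 : ℝ)).indicator (hA p)) measurable_const
  let f : ℕ × ℕ → Lp EllTwo 2 μ := fun p => (hL p).toLp _
  have hf : ∀ p, f p ∈ LTwoMult μ m := by
    intro p
    change ∀ᵐ x ∂μ, ∀ k : ℕ, m x ≤ (k : ℕ∞) → (f p) x k = 0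
    filter_upwards [(hL p).coeFn_toLp, hmm] with x h1 h2 k hk
    rw [h1]
    change ((√((A p).indicator (1 : X → ℝ) x) : ℝ) : ℂ) • (coordVec p.1 k) = 0
    by_cases hx : x ∈ A p
    · rw [coordVec_ne, smul_zero]
      rintro rfl
      exact absurd hx.2 (not_lt.2 (h2 ▸ hk))
    · simp [hx]
  let e : ℕ × ℕ → K := fun p => J.symm ⟨f p, hf p⟩
  let ξ : ℕ × ℕ → H := fun p => U.symm (e p)
  have hJe : ∀ p g, J ⟨ρ g (e p), hK g _ (e p).2⟩ = mulRep μ g (f p) := fun p g => by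
    rw [hJ, LinearIsometryEquiv.apply_symm_apply]
  have hUρ : ∀ g v, U (ρ g (U.symm v)) = ρ (Lp.compMeasurePreserving r hr g) v := fun g v => by
    have := hU g (U.symm v)
    simpa using this
  -- Moving by `U` and then by `J` turns `ρ g` into multiplication by `g ∘ r`.
  have hin : ∀ p q g, inner ℂ (ξ p) (ρ g (ξ q)) = ∫ x, g (r x) *
      (if p.1 = q.1 then ((√((A p).indicator (1 : X → ℝ) x) *
        √((A q).indicator (1 : X → ℝ) x) : ℝ) : ℂ) else 0) ∂μ := by
    intro p q g
    rw [← U.inner_map_map, hUρ, LinearIsometryEquiv.apply_symm_apply]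
    have h1 := J.inner_map_map (e p)
      ⟨ρ (Lp.compMeasurePreserving r hr g) (e q), hK _ _ (e q).2⟩
    rw [Submodule.coe_inner, Submodule.coe_inner, hJe, LinearIsometryEquiv.apply_symm_apply,
      inner_mulRep] at h1
    rw [← h1]
    refine integral_congr_ae ?_
    filter_upwards [(hL p).coeFn_toLp, (hL q).coeFn_toLp,
      Lp.coeFn_compMeasurePreserving g hr] with x h2 h3 h4
    rw [h2, h3, h4, inner_weight]
    rfl
  have hwm := fun p => h.aemeasurable_fibreWeight hfin (hA p)
  -- `fibreWeight` is only a.e. measurable, while a system needs densities that are measurable and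
  -- nonnegative everywhere.
  let w : ℕ × ℕ → X → ℝ := fun p x => max 0 ((hwm p).mk _ x)
  have hw : ∀ p, w p =ᵐ[μ] fibreWeight r (A p) := by
    intro p
    filter_upwards [(hwm p).ae_eq_mk] with x hx
    simp only [w, ← hx]
    exact max_eq_right (fibreWeight_nonneg r _ x)
  refine ⟨ξ, w, ⟨fun p => ⟨e p, (e p).2, rfl⟩, fun p => measurable_const.max (hwm p).measurable_mk,
    fun p x => le_max_left _ _, fun p => (h.integrable_fibreWeight hfin (hA p)).congr (hw p).symm,
    fun p g => ?_, fun p q hpq g => ?_, fun v hv hz => ?_⟩, hw⟩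
  · have h1 : ∫ x, g x * (w p x : ℂ) ∂μ = ∫ x, g x * (fibreWeight r (A p) x : ℂ) ∂μ := by
      refine integral_congr_ae ?_
      filter_upwards [hw p] with x hx
      rw [hx]
    rw [hin, h1, ← h.integral_comp_mul_indicator hr hfin g (hA p)]
    congr 1
    funext x
    by_cases hx : x ∈ A p <;> simp [hx]
  · rw [hin]
    refine integral_eq_zero_of_ae (Filter.Eventually.of_forall fun x => ?_)
    change g (r x) * _ = 0
    split_ifs with h1
    · have h2 : p.2 ≠ q.2 := fun h2 => hpq (Prod.ext h1 h2)
      by_cases hx : x ∈ A p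
      · have hx' : x ∉ A q := fun hq => Set.disjoint_left.1 (hdisj h2) hx.1 hq.1
        simp [hx']
      · simp [hx]
    · simp
  · obtain ⟨v', hv', rfl⟩ := hv
    change ∀ p g, inner ℂ (ρ g (ξ p)) (U.symm v') = 0 at hz
    change U.symm v' = 0
    set F : Lp EllTwo 2 μ := ((J ⟨v', hv'⟩ : LTwoMult μ m) : Lp EllTwo 2 μ)
    have hzero : ∀ p, (fun x => (inner ℂ (f p x) (F x) : ℂ)) =ᵐ[μ] fun _ => 0 := by
      intro p
      refine h.ae_eq_zero_of_integral_comp_mul hr hfin (hA p) (hAinj p)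
        (integrable_inner_coeFn _ _) ?_ fun B hB => ?_
      · filter_upwards [(hL p).coeFn_toLp] with x h1 hx
        rw [h1]
        simp [hx]
      · have h1 := hz p (indLp μ hB)
        rw [← U.inner_map_map, hUρ, LinearIsometryEquiv.apply_symm_apply] at h1
        have h2 := J.inner_map_map
          ⟨ρ (Lp.compMeasurePreserving r hr (indLp μ hB)) (e p), hK _ _ (e p).2⟩ ⟨v', hv'⟩
        rw [Submodule.coe_inner, Submodule.coe_inner, hJe, h1, isRepresentation_mulRep.inner_left,
          inner_mulRep] at h2
        rw [← h2]
        refine integral_congr_ae ?_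
        filter_upwards [coeFn_star_comp hr hB] with x hx
        rw [hx]
    have hF0 : F = 0 := by
      refine Lp.ext ?_
      have hFm : ∀ᵐ x ∂μ, ∀ k : ℕ, m x ≤ (k : ℕ∞) → F x k = 0 := (J ⟨v', hv'⟩).2
      filter_upwards [ae_all_iff.2 hzero, ae_all_iff.2 fun p => (hL p).coeFn_toLp, hFm, hmm, hcov,
        Lp.coeFn_zero EllTwo 2 μ] with x h1 h2 h3 h4 ⟨k, hk⟩ h6
      rw [h6]
      ext j
      change F x j = 0
      by_cases hj : (j : ℕ∞) < m x
      · have hx : x ∈ A (j, k) := ⟨hk, by rw [h4] at hj; exact hj⟩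
        have := h1 (j, k)
        rw [h2, inner_smul_left, inner_coordVec] at this
        simpa [hx] using this
      · exact h3 j (not_lt.1 hj)
    have hJ0 : J ⟨v', hv'⟩ = 0 := Subtype.ext hF0
    have hv0 : v' = 0 := congrArg Subtype.val ((map_eq_zero_iff J J.injective).1 hJ0)
    rw [hv0, map_zero]

variable [CompleteSpace H]

/-- If `m` is a multiplicity function on `K`, then `x ↦ ∑_{r(y)=x} m(y)` is, up to a null set, one
on `U⁻¹ K`. -/
theorem IsStronglyInvariant.exists_isMultiplicityFunction_map (h : IsStronglyInvariant r μ)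
    (hr : MeasurePreserving r μ μ) (hfin : ∀ x, (r ⁻¹' {x}).Finite)
    (hsep : FibresCountablySeparated r)
    {ρ : Lp ℂ ∞ μ →ₗ[ℂ] (H →L[ℂ] H)} (hρ : IsRepresentation ρ) (U : H ≃ₗᵢ[ℂ] H)
    (hU : IsCovariant hr U.toLinearIsometry ρ) {K : Submodule ℂ H} {m : X → ℕ∞}
    (hm : IsMultiplicityFunction ρ K m)
    (hc : IsClosed ((K.map (U.symm.toLinearEquiv : H →ₗ[ℂ] H) : Submodule ℂ H) : Set H))
    (hinv : ∀ g, ∀ v ∈ K.map (U.symm.toLinearEquiv : H →ₗ[ℂ] H),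
      ρ g v ∈ K.map (U.symm.toLinearEquiv : H →ₗ[ℂ] H)) :
    ∃ m₁, IsMultiplicityFunction ρ (K.map (U.symm.toLinearEquiv : H →ₗ[ℂ] H)) m₁ ∧
      ∀ᵐ x ∂μ, m₁ x = fibreSum r m x := by
  obtain ⟨D, hD, hdisj, hinj, hcov⟩ := h.exists_partition hr hfin hsep
  have hmm := hm.1.ae_eq_mk
  obtain ⟨ξ, w, hsys, hw⟩ := h.exists_fibreSystem hr hfin hD hdisj hinj hcov U hU hm
    hm.1.measurable_mk hmm
  refine ⟨_, hsys.isMultiplicityFunction hρ hc hinv, ?_⟩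
  -- The covering by the `D k` and the equality of `m` with its representative are needed at every
  -- point of the fibre over `x`.
  filter_upwards [ae_all_iff.2 hw, h.ae_forall_fibre hfin hcov, h.ae_forall_fibre hfin hmm]
    with x h1 h2 h3
  have h4 : fibreSum r m x = fibreSum r (hm.1.mk m) x := finsum_mem_congr rfl h3
  rw [h4, ← encard_fibre_eq_fibreSum hfin hdisj hinj _ h2]
  congr 1
  ext p
  simp only [h1 p, fibreWeight_ne_zero hfin, Set.mem_ofPred_eq]

end Covariance

/-! ### The subspaces `V₀`, `V₁` and `W₀` of the dilation -/

section Dilation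

variable {X : Type*} [MeasurableSpace X] {μ : Measure X} [IsFiniteMeasure μ] {r : X → X}
variable {H : Type*} [NormedAddCommGroup H] [InnerProductSpace ℂ H]
variable {H' : Type*} [NormedAddCommGroup H'] [InnerProductSpace ℂ H']
variable {hr : MeasurePreserving r μ μ} {S : H →ₗᵢ[ℂ] H} {π : Lp ℂ ∞ μ →ₗ[ℂ] (H →L[ℂ] H)}
  {ι : H →ₗᵢ[ℂ] H'} {S' : H' ≃ₗᵢ[ℂ] H'} {π' : Lp ℂ ∞ μ →ₗ[ℂ] (H' →L[ℂ] H')}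

theorem isClosed_spaceV0 [CompleteSpace H] (ι : H →ₗᵢ[ℂ] H') : IsClosed (spaceV0 ι : Set H') := by
  have : (spaceV0 ι : Set H') = Set.range ι := by ext; simp [spaceV0]
  rw [this]
  exact ι.isometry.isClosedEmbedding.isClosed_range

theorem isClosed_spaceV1 [CompleteSpace H] (ι : H →ₗᵢ[ℂ] H') (S' : H' ≃ₗᵢ[ℂ] H') :
    IsClosed (spaceV1 ι S' : Set H') := by
  have : (spaceV1 ι S' : Set H') = S'.symm '' (spaceV0 ι : Set H') := by
    ext; simp [spaceV1]
  rw [this]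
  exact S'.symm.toHomeomorph.isClosedMap _ (isClosed_spaceV0 ι)

theorem isClosed_spaceW0 [CompleteSpace H] (ι : H →ₗᵢ[ℂ] H') (S' : H' ≃ₗᵢ[ℂ] H') :
    IsClosed (spaceW0 ι S' : Set H') :=
  (isClosed_spaceV1 ι S').inter (Submodule.isClosed_orthogonal _)

variable [CompleteSpace H']

namespace IsCovariantDilation

theorem spaceV0_le_spaceV1 (h : IsCovariantDilation hr S π ι S' π') :
    spaceV0 ι ≤ spaceV1 ι S' := by
  rintro _ ⟨ξ, rfl⟩
  refine ⟨ι (S ξ), ⟨S ξ, rfl⟩, ?_⟩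
  change S'.symm (ι (S ξ)) = ι ξ
  rw [← h.extends_isometry, LinearIsometryEquiv.symm_apply_apply]

theorem spaceV0_invariant (h : IsCovariantDilation hr S π ι S' π') (g : Lp ℂ ∞ μ) :
    ∀ v ∈ spaceV0 ι, π' g v ∈ spaceV0 ι := by
  rintro _ ⟨ξ, rfl⟩
  exact ⟨π g ξ, (h.extends_rep g ξ).symm⟩

theorem spaceV1_invariant (h : IsCovariantDilation hr S π ι S' π') (g : Lp ℂ ∞ μ) :
    ∀ v ∈ spaceV1 ι S', π' g v ∈ spaceV1 ι S' := by
  rintro _ ⟨v, hv, rfl⟩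
  refine ⟨_, h.spaceV0_invariant (Lp.compMeasurePreserving r hr g) v hv, ?_⟩
  have h1 : S' (π' g (S'.symm v)) = π' (Lp.compMeasurePreserving r hr g) v := by
    simpa using h.covariant g (S'.symm v)
  change S'.symm (π' (Lp.compMeasurePreserving r hr g) v) = π' g (S'.symm v)
  rw [← h1, LinearIsometryEquiv.symm_apply_apply]

theorem spaceW0_invariant (h : IsCovariantDilation hr S π ι S' π') (g : Lp ℂ ∞ μ) :
    ∀ v ∈ spaceW0 ι S', π' g v ∈ spaceW0 ι S' := by
  rintro v ⟨hv1, hv0⟩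
  refine ⟨h.spaceV1_invariant g v hv1, fun u hu => ?_⟩
  rw [← star_star g, ← h.isRepresentation.inner_left]
  exact hv0 _ (h.spaceV0_invariant _ u hu)

variable [CompleteSpace H]

theorem exists_isMultiplicityFunction_spaceV0 (h : IsCovariantDilation hr S π ι S' π')
    (hnormal : IsNormalRep π) (hgen : IsCountablyGenerated π) :
    ∃ m, IsMultiplicityFunction π' (spaceV0 ι) m := by
  obtain ⟨C, hC, hspan⟩ := hgen
  -- Adding the zero vector makes the generating set nonempty, hence the range of a sequence.
  obtain ⟨c, hc⟩ := (hC.insert (0 : H)).exists_eq_range (Set.insert_nonempty _ _)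
  obtain ⟨ξ, w, hsys⟩ := exists_isOrthogonalSystem h.isRepresentation (isClosed_spaceV0 ι)
    h.spaceV0_invariant (by
      rintro _ ⟨ξ, rfl⟩
      obtain ⟨w, hw, hg⟩ := hnormal ξ ξ
      refine ⟨w, hw, fun g => ?_⟩
      rw [← hg]
      change inner ℂ (ι ξ) (π' g (ι ξ)) = _
      rw [h.extends_rep, ι.inner_map_map])
    (fun i => ι (c i)) (fun i => ⟨c i, rfl⟩) (by
      rintro _ ⟨u, rfl⟩ hz
      change ∀ i g, inner ℂ (π' g (ι (c i))) (ι u) = 0 at hz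
      have hle : (⊤ : Submodule ℂ H) ≤ (Submodule.span ℂ {u})ᗮ := by
        rw [← hspan]
        refine Submodule.topologicalClosure_minimal _ (Submodule.span_le.2 ?_)
          (Submodule.isClosed_orthogonal _)
        rintro _ ⟨g, k, hk, rfl⟩
        obtain ⟨i, rfl⟩ : k ∈ Set.range c := hc ▸ Set.mem_insert_of_mem _ hk
        have := hz i g
        rw [h.extends_rep, ι.inner_map_map] at this
        exact Submodule.mem_orthogonal_singleton_iff_inner_left.2 this
      have hu : inner ℂ u u = 0 :=
        Submodule.mem_orthogonal_singleton_iff_inner_left.1 (hle (Submodule.mem_top (x := u)))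
      rw [inner_self_eq_zero.1 hu, map_zero])
  exact ⟨_, hsys.isMultiplicityFunction h.isRepresentation (isClosed_spaceV0 ι)
    h.spaceV0_invariant⟩

theorem exists_add_eq (h : IsCovariantDilation hr S π ι S' π') :
    ∀ v ∈ spaceV1 ι S', ∃ v₁ ∈ spaceV0 ι, ∃ v₂ ∈ spaceW0 ι S', v = v₁ + v₂ := by
  intro v hv
  have : CompleteSpace (spaceV0 ι) := (isClosed_spaceV0 ι).completeSpace_coe
  refine ⟨(spaceV0 ι).orthogonalProjectionOnto v, Subtype.mem _,
    v - (spaceV0 ι).orthogonalProjectionOnto v, ⟨?_, ?_⟩, by simp⟩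
  · exact (spaceV1 ι S').sub_mem hv (h.spaceV0_le_spaceV1 (Subtype.mem _))
  · exact Submodule.sub_starProjection_mem_orthogonal _

end IsCovariantDilation

end Dilation

end MultiplicityDilation

end

/-! ### The main theorem -/

open MultiplicityDilation in
theorem mainTheorem3 {X : Type*} [MeasurableSpace X] (μ : Measure X) [IsProbabilityMeasure μ]
    (r : X → X) (hr : Measurable r) (hsurj : Function.Surjective r)
    (hfin : ∀ x, (r ⁻¹' {x}).Finite) (hinv : IsStronglyInvariant r μ)
    (hsep : FibresCountablySeparated r)
    {H : Type*} [NormedAddCommGroup H] [InnerProductSpace ℂ H] [CompleteSpace H]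
    (S : H →ₗᵢ[ℂ] H) (π : Lp ℂ ∞ μ →ₗ[ℂ] (H →L[ℂ] H))
    (hπ : IsRepresentation π) (hnormal : IsNormalRep π) (hgen : IsCountablyGenerated π)
    (hcov : IsCovariant (hinv.measurePreserving hr hsurj hfin) S π)
    {H' : Type*} [NormedAddCommGroup H'] [InnerProductSpace ℂ H'] [CompleteSpace H']
    (ι : H →ₗᵢ[ℂ] H') (S' : H' ≃ₗᵢ[ℂ] H') (π' : Lp ℂ ∞ μ →ₗ[ℂ] (H' →L[ℂ] H'))
    (hdil : IsCovariantDilation (hinv.measurePreserving hr hsurj hfin) S π ι S' π') :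
    -- `V₀ ⊆ V₁`, and `V₁` and `W₀` are invariant
    (spaceV0 ι ≤ spaceV1 ι S' ∧
      (∀ g : Lp ℂ ∞ μ, ∀ v ∈ spaceV1 ι S', π' g v ∈ spaceV1 ι S') ∧
      (∀ g : Lp ℂ ∞ μ, ∀ v ∈ spaceW0 ι S', π' g v ∈ spaceW0 ι S')) ∧
    -- the multiplicity functions exist
    ((∃ m, IsMultiplicityFunction π' (spaceV0 ι) m) ∧
      (∃ m, IsMultiplicityFunction π' (spaceV1 ι S') m) ∧
      (∃ m, IsMultiplicityFunction π' (spaceW0 ι S') m)) ∧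
    -- and satisfy both relations
    (∀ m₀ m₁ : X → ℕ∞, IsMultiplicityFunction π' (spaceV0 ι) m₀ →
      IsMultiplicityFunction π' (spaceV1 ι S') m₁ →
      ∀ᵐ x ∂μ, m₁ x = fibreSum r m₀ x) ∧
    (∀ m₀ w₀ : X → ℕ∞, IsMultiplicityFunction π' (spaceV0 ι) m₀ →
      IsMultiplicityFunction π' (spaceW0 ι S') w₀ →
      ∀ᵐ x ∂μ, m₀ x + w₀ x = fibreSum r m₀ x) := by
  have hV0 := hdil.exists_isMultiplicityFunction_spaceV0 hnormal hgen
  have hV1 : ∀ m, IsMultiplicityFunction π' (spaceV0 ι) m →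
      ∃ m₁, IsMultiplicityFunction π' (spaceV1 ι S') m₁ ∧ ∀ᵐ x ∂μ, m₁ x = fibreSum r m x :=
    fun m hm => hinv.exists_isMultiplicityFunction_map _ hfin hsep hdil.isRepresentation S'
      hdil.covariant hm (isClosed_spaceV1 ι S') hdil.spaceV1_invariant
  have hW0V1 : spaceW0 ι S' ≤ spaceV1 ι S' := inf_le_left
  refine ⟨⟨hdil.spaceV0_le_spaceV1, hdil.spaceV1_invariant, hdil.spaceW0_invariant⟩,
    ⟨hV0, ?_, ?_⟩, fun m₀ m₁ h₀ h₁ => ?_, fun m₀ w₀ h₀ hw => ?_⟩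
  · obtain ⟨m, hm⟩ := hV0
    obtain ⟨m₁, hm₁, -⟩ := hV1 m hm
    exact ⟨m₁, hm₁⟩
  · obtain ⟨m, hm⟩ := hV0
    obtain ⟨m₁, hm₁, -⟩ := hV1 m hm
    exact hm₁.exists_of_le hdil.isRepresentation hW0V1 (isClosed_spaceW0 ι S')
      hdil.spaceW0_invariant
  · obtain ⟨m, hm, hsum⟩ := hV1 m₀ h₀
    -- The formula is known for one multiplicity function on `V₁`; uniqueness transfers it to any
    -- other.
    filter_upwards [h₁.ae_eq hm, hsum] with x h1 h2
    rw [h1, h2]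
  · obtain ⟨m, hm, hsum⟩ := hV1 m₀ h₀
    filter_upwards [IsMultiplicityFunction.add hdil.isRepresentation h₀ hw hm
      (isClosed_spaceV1 ι S') hdil.spaceV0_le_spaceV1 hW0V1 inf_le_right hdil.exists_add_eq, hsum]
      with x h1 h2
    rw [h1, h2]
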